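/- **Definitions.** For a join-semilattice $S$ with zero let $S^-=S\setminus\{0\}$. For join-semilattices $A,B$ with zero, the *tensor product* $A\otimes B$ is the free $\{\vee,0\}$-semilattice generated by the set $A^-\times B^-$ subject to the relations $$\langle a,b_0\rangle\vee\langle a,b_1\rangle=\langle a,b_0\vee b_1\rangle,\qquad \langle a_0,b\rangle\vee\langle a_1,b\rangle=\langle a_0\vee a_1,b\rangle$$ for $a,a_0,a_1\in A^-$ and $b,b_0,b_1\in B^-$. We say that $A\otimes B$ *is a lattice* if any two of its elements have a greatest lower bound. $\mathrm F(3)$ is the free lattice on three generators; its zero is the meet of the generators. An *embedding* of join-semilattices is an injective map preserving binary joins. For a join-semilattice $L$, $\mathrm{Id}\,L$ is the join-semilattice of nonempty ideals of $L$, ordered by inclusion. For a finite lattice $A$, let $\mathrm J(A)$ be the set of its (nonzero) join-irreducible elements, and for $X,Y\subseteq \mathrm J(A)$ write $X\ll Y$ if every $x\in X$ lies below some $y\in Y$. A *minimal pair* of $A$ is a pair $\langle p,I\rangle$ with $p\in\mathrm J(A)$, $I\subseteq\mathrm J(A)$, $|I|\ge 2$, $p\notin I$, $p\le\bigvee I$,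 such that for every $J\subseteq\mathrm J(A)$ with $J\ll I$ and $p\le\bigvee J$ we have $I\subseteq J$. **Theorem.** For a finite (nonempty) lattice $A$, the following conditions are equivalent: 1. $A$ is *amenable*: $A\otimes L$ is a lattice for every lattice $L$ with zero. 2. $A$ is *sharply transferable as a join-semilattice*: for every join-semilattice $L$ and every embedding $\varphi$ of the join-semilattice $A$ into $\mathrm{Id}\,L$, there is an embedding $\xi$ of the join-semilattice $A$ into $L$ such that, for all $x,y\in A$, $\xi(x)\in\varphi(y)$ if and only if $x\le y$. 3. $A\otimes\mathrm F(3)$ is a lattice. 4. $A$ satisfies Gaskill's condition $(\mathrm T_\vee)$: there is a linear ordering $\trianglelefteq$ of the set $\mathrm J(A)$ such that $p\trianglelefteq j$ for every minimal pair $\langle p,I\rangle$ of $A$ and every $j\in I$. -/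

import Mathlib

universe u v w

namespace Amenable

/-! ## The tensor product of two join-semilattices with zero -/

section TensorProduct

variable (A : Type u) (B : Type v) [SemilatticeSup A] [OrderBot A] [SemilatticeSup B] [OrderBot B]

/-- The set `A⁻ = A - {0}` of nonzero elements. -/
abbrev NonBot (A : Type u) [SemilatticeSup A] [OrderBot A] : Type u := {a : A // a ≠ ⊥}

variable {A} in
/-- The join of two nonzero elements, as a nonzero element. -/
def NonBot.join (a b : NonBot A) : NonBot A :=
  ⟨a.1 ⊔ b.1, fun h => a.2 (sup_eq_bot_iff.mp h).1⟩

open Classical in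
/-- The least `{∨, 0}`-congruence on the free `{∨, 0}`-semilattice over `A⁻ × B⁻` that contains the
defining relations of the tensor product. The free `{∨, 0}`-semilattice over a set `X` is the
set of all finite subsets of `X`, with union as join and `∅` as zero; the generator
`x` is `{x}`. -/
inductive TensorRel : Finset (NonBot A × NonBot B) → Finset (NonBot A × NonBot B) → Prop
  | refl (s) : TensorRel s s
  | symm {s t} : TensorRel s t → TensorRel t s
  | trans {s t r} : TensorRel s t → TensorRel t r → TensorRel s r
  | union {s s' t t'} : TensorRel s s' → TensorRel t t' → TensorRel (s ∪ t) (s' ∪ t')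
  | join_right (a : NonBot A) (b₀ b₁ : NonBot B) :
      TensorRel ({(a, b₀)} ∪ {(a, b₁)}) {(a, b₀.join b₁)}
  | join_left (a₀ a₁ : NonBot A) (b : NonBot B) :
      TensorRel ({(a₀, b)} ∪ {(a₁, b)}) {(a₀.join a₁, b)}

/-- The congruence `TensorRel` as a setoid. -/
def tensorSetoid : Setoid (Finset (NonBot A × NonBot B)) where
  r := TensorRel A B
  iseqv := ⟨TensorRel.refl, TensorRel.symm, TensorRel.trans⟩

/-- The tensor product `A ⊗ B`: the free `{∨, 0}`-semilattice generated by `A⁻ × B⁻` subject to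
`⟨a, b₀⟩ ∨ ⟨a, b₁⟩ = ⟨a, b₀ ∨ b₁⟩` and `⟨a₀, b⟩ ∨ ⟨a₁, b⟩ = ⟨a₀ ∨ a₁, b⟩`. -/
def Tensor : Type (max u v) := Quotient (tensorSetoid A B)

variable {A B} in
/-- The element of the tensor product represented by a finite set of generators, namely their
join. -/
def Tensor.mk (s : Finset (NonBot A × NonBot B)) : Tensor A B := Quotient.mk (tensorSetoid A B) s

open Classical in
noncomputable instance : Max (Tensor A B) where
  max := Quotient.map₂ (· ∪ ·) fun _ _ h _ _ h' => TensorRel.union h h'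

open Classical in
/-- The order is the one of the join-semilattice: `x ≤ y` if and only if `x ∨ y = y`. -/
noncomputable instance : SemilatticeSup (Tensor A B) :=
  SemilatticeSup.mk'
    (by rintro ⟨a⟩ ⟨b⟩; exact congrArg Tensor.mk (Finset.union_comm a b))
    (by rintro ⟨a⟩ ⟨b⟩ ⟨c⟩; exact congrArg Tensor.mk (Finset.union_assoc a b c))
    (by rintro ⟨a⟩; exact congrArg Tensor.mk (Finset.union_idempotent a))

open Classical in
noncomputable instance : OrderBot (Tensor A B) where
  bot := Tensor.mk ∅
  bot_le := by rintro ⟨a⟩; exact congrArg Tensor.mk (Finset.empty_union a)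

end TensorProduct

/-- A join-semilattice is a lattice if and only if any two elements have a greatest lower bound. -/
def IsLatticeOrdered (S : Type u) [SemilatticeSup S] : Prop :=
  ∀ x y : S, ∃ z, IsGLB {x, y} z

/-! ## Free lattices -/

/-- Lattice terms in the variables `X`. -/
inductive LatTerm (X : Type u) : Type u
  | var : X → LatTerm X
  | inf : LatTerm X → LatTerm X → LatTerm X
  | sup : LatTerm X → LatTerm X → LatTerm X

/-- `LatTerm.Le s t`: the inequality `s ≤ t` is a consequence of the axioms of lattices. -/
inductive LatTerm.Le {X : Type u} : LatTerm X → LatTerm X → Prop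
  | refl (s) : LatTerm.Le s s
  | trans {s t r} : LatTerm.Le s t → LatTerm.Le t r → LatTerm.Le s r
  | inf_le_left (s t) : LatTerm.Le (.inf s t) s
  | inf_le_right (s t) : LatTerm.Le (.inf s t) t
  | le_inf {s t r} : LatTerm.Le s t → LatTerm.Le s r → LatTerm.Le s (.inf t r)
  | le_sup_left (s t) : LatTerm.Le s (.sup s t)
  | le_sup_right (s t) : LatTerm.Le t (.sup s t)
  | sup_le {s t r} : LatTerm.Le s r → LatTerm.Le t r → LatTerm.Le (.sup s t) r

/-- Two terms are identified if each is provably below the other. -/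
def latSetoid (X : Type u) : Setoid (LatTerm X) where
  r s t := s.Le t ∧ t.Le s
  iseqv := ⟨fun s => ⟨.refl s, .refl s⟩, fun h => ⟨h.2, h.1⟩,
    fun h k => ⟨h.1.trans k.1, k.2.trans h.2⟩⟩

/-- The free lattice on the set `X` of generators. -/
def FreeLat (X : Type u) : Type u := Quotient (latSetoid X)

namespace FreeLat

variable {X : Type u}

/-- The class of a term. -/
def mk (s : LatTerm X) : FreeLat X := Quotient.mk (latSetoid X) s

instance : PartialOrder (FreeLat X) where
  le := Quotient.lift₂ LatTerm.Le fun _ _ _ _ h k =>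
    propext ⟨fun e => (h.2.trans e).trans k.1, fun e => (h.1.trans e).trans k.2⟩
  le_refl := by rintro ⟨s⟩; exact LatTerm.Le.refl s
  le_trans := by rintro ⟨s⟩ ⟨t⟩ ⟨r⟩ h k; exact LatTerm.Le.trans h k
  le_antisymm := by rintro ⟨s⟩ ⟨t⟩ h k; exact Quotient.sound ⟨h, k⟩

instance : Lattice (FreeLat X) where
  sup := Quotient.map₂ LatTerm.sup fun _ _ h _ _ k =>
    ⟨.sup_le (h.1.trans (.le_sup_left _ _)) (k.1.trans (.le_sup_right _ _)),
      .sup_le (h.2.trans (.le_sup_left _ _)) (k.2.trans (.le_sup_right _ _))⟩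
  inf := Quotient.map₂ LatTerm.inf fun _ _ h _ _ k =>
    ⟨.le_inf (.trans (.inf_le_left _ _) h.1) (.trans (.inf_le_right _ _) k.1),
      .le_inf (.trans (.inf_le_left _ _) h.2) (.trans (.inf_le_right _ _) k.2)⟩
  le_sup_left := by rintro ⟨s⟩ ⟨t⟩; exact LatTerm.Le.le_sup_left s t
  le_sup_right := by rintro ⟨s⟩ ⟨t⟩; exact LatTerm.Le.le_sup_right s t
  sup_le := by rintro ⟨s⟩ ⟨t⟩ ⟨r⟩ h k; exact LatTerm.Le.sup_le h k
  inf_le_left := by rintro ⟨s⟩ ⟨t⟩; exact LatTerm.Le.inf_le_left s t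
  inf_le_right := by rintro ⟨s⟩ ⟨t⟩; exact LatTerm.Le.inf_le_right s t
  le_inf := by rintro ⟨s⟩ ⟨t⟩ ⟨r⟩ h k; exact LatTerm.Le.le_inf h k

end FreeLat

/-- `F(3)`, the free lattice on three generators. -/
abbrev F3 : Type := FreeLat (Fin 3)

/-- The zero of `F(3)` is the meet of the three generators. -/
instance : OrderBot F3 where
  bot := FreeLat.mk (.inf (.var 0) (.inf (.var 1) (.var 2)))
  bot_le := by
    rintro ⟨s⟩
    change LatTerm.Le _ s
    induction s with
    | var i =>
      fin_cases i
      · exact .inf_le_left _ _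
      · exact .trans (.inf_le_right _ _) (.inf_le_left _ _)
      · exact .trans (.inf_le_right _ _) (.inf_le_right _ _)
    | inf s t hs ht => exact .le_inf hs ht
    | sup s t hs _ => exact hs.trans (.le_sup_left _ _)

/-! ## The four conditions -/

/-- A finite (hence with zero) lattice `A` is amenable if `A ⊗ L` is a lattice for every lattice `L`
with zero. -/
def IsAmenable (A : Type u) [Lattice A] [OrderBot A] : Prop :=
  ∀ (L : Type v) [Lattice L] [OrderBot L], IsLatticeOrdered (Tensor A L)

/-- An embedding of join-semilattices: an injective map `f` with `f (x ∨ y) = f x ∨ f y`, written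
as `f (x ∨ y)` being the least upper bound of `f x` and `f y`. -/
def IsJoinEmbedding {S : Type u} {T : Type v} [SemilatticeSup S] [PartialOrder T] (f : S → T) :
    Prop :=
  Function.Injective f ∧ ∀ x y, IsLUB {f x, f y} (f (x ⊔ y))

/-- Sharp transferability of a join-semilattice `S`: for every join-semilattice `L` and every
embedding `φ` of `S` into the join-semilattice of (nonempty) ideals of `L`, there is an embedding
`ξ` of `S` into `L` with `ξ x ∈ φ y ↔ x ≤ y`. -/
def IsSharplyTransferable (S : Type u) [SemilatticeSup S] : Prop :=
  ∀ (L : Type v) [SemilatticeSup L] (φ : S → Order.Ideal L), IsJoinEmbedding φ →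
    ∃ ξ : S → L, IsJoinEmbedding ξ ∧ ∀ x y, ξ x ∈ φ y ↔ x ≤ y

section ConditionT

variable (S : Type u) [SemilatticeSup S] [OrderBot S]

/-- The set of join-irreducible elements. -/
abbrev JoinIrr : Type u := {p : S // SupIrred p}

variable {S} in
/-- `X` is dominated by `Y`. -/
def Dominated (X Y : Finset (JoinIrr S)) : Prop := ∀ x ∈ X, ∃ y ∈ Y, x ≤ y

variable {S} in
/-- The join in `S` of a finite set of join-irreducible elements. -/
def bigJoin (I : Finset (JoinIrr S)) : S := I.sup Subtype.val

variable {S} in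
/-- Minimal pairs `⟨p, I⟩`. -/
structure IsMinimalPair (p : JoinIrr S) (I : Finset (JoinIrr S)) : Prop where
  two_le_card : 2 ≤ I.card
  notMem : p ∉ I
  le_join : p.1 ≤ bigJoin I
  minimal : ∀ J : Finset (JoinIrr S), Dominated J I → p.1 ≤ bigJoin J → I ⊆ J

/-- Condition (T) for a finite join-semilattice with zero. For a lattice, which is a
join-semilattice by its join operation, this is condition (T_∨). -/
def ConditionT : Prop :=
  ∃ r : JoinIrr S → JoinIrr S → Prop, IsLinearOrder (JoinIrr S) r ∧
    ∀ p I, IsMinimalPair p I → ∀ j ∈ I, r p j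

end ConditionT

end Amenable

/-!
All four conditions on the finite lattice `A` say that the relation `Depends` on its
join-irreducible elements, `p` depends on `j` if `j ∈ I` for some minimal pair `⟨p, I⟩`, is
well-founded, that is, has no cycles. For condition (T) this is `conditionT_iff_wellFounded`.

*Sharp transferability.* If `Depends` is well-founded, a lift of an embedding `φ : A → Id L` is
chosen on the join-irreducible elements by recursion: the value at `p` lies in the join of the
ideals `φ j`, `j ∈ I`, for each minimal pair `⟨p, I⟩`, so the values at the `j ∈ I` can afterwards
be taken large enough for their join to be above it (`exists_joinIrr_lift`). Conversely, in the
semilattice `LevelFun` an element `p` of level `n` is covered, through a minimal pair `⟨p, I⟩`, by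
the elements of `I` of level `n + 1`, but no longer if one of these has level at most `n`, and so
a sharp lift of the embedding `LevelFun.ideal` assigns to the join-irreducible elements levels
that increase strictly along `Depends` (`LevelFun.level_lt_level`).

*Tensor products.* The bi-ideal of `A × L` generated by pairs `(p, g p)` with `p` join-irreducible
is described by the increasing sequence of the iterates `adjust^[n] g`, where `adjust g p` is the
join of the meets of `g` over all covers of `p`. Only minimal pairs matter, so if `Depends` is
well-founded the sequence becomes stationary (`exists_iterate_adjust_stationary`), every element
of `A ⊗ L` is capped by a single function `JoinIrr A → L`, and pointwise meets of such functions
give the meets of `A ⊗ L`.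

Conversely, let `A ⊗ L` be a lattice, where `L` contains the free lattice on generators `x p`, for
`p` join-irreducible, and `w`. The meet of `⋁ p ⊗ x p` and `⋁ p ⊗ w` is finitely generated, hence
generated by the tensors `p ⊗ (w ⊓ adjust^[n] x p)` for some `n`. By Whitman's condition, this
forces `w ⊓ adjust^[m] x p ≤ w ⊓ adjust^[n] x p` for all `m` (`inf_le_cutGen`). Mapping `w` to the
top of an arbitrary lattice shows that `adjust^[n]` is stationary everywhere, whereas an infinite
sequence of `p₍ₖ₊₁₎` depending on `pₖ` yields a function into `ChainLattice` whose adjustments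
keep growing. For `L = F(3)` it remains to embed finitely generated free lattices into `F(3)`
(`FreeLat.exists_embedding_F3`), and a copy of `F(3)` in another universe serves for amenability.
-/

namespace Amenable

/-! ### Whitman's solution of the word problem in free lattices -/

namespace LatTerm

variable {X : Type u}

/-- Whitman's cut-free calculus for inequalities between lattice terms: `LatTerm.Le` without
transitivity. -/
inductive CutFree : LatTerm X → LatTerm X → Prop
  | var (i) : CutFree (.var i) (.var i)
  | inf_left {s r} (t) : CutFree s r → CutFree (.inf s t) r
  | inf_right {t r} (s) : CutFree t r → CutFree (.inf s t) r
  | le_inf {s t r} : CutFree s t → CutFree s r → CutFree s (.inf t r)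
  | sup_left {s t} (r) : CutFree s t → CutFree s (.sup t r)
  | sup_right {s r} (t) : CutFree s r → CutFree s (.sup t r)
  | sup_le {s t r} : CutFree s r → CutFree t r → CutFree (.sup s t) r

namespace CutFree

theorem refl (s : LatTerm X) : CutFree s s := by
  induction s with
  | var i => exact .var i
  | inf s t hs ht => exact .le_inf (.inf_left _ hs) (.inf_right _ ht)
  | sup s t hs ht => exact .sup_le (.sup_left _ hs) (.sup_right _ ht)

theorem sup_le_iff {s t r : LatTerm X} : CutFree (.sup s t) r ↔ CutFree s r ∧ CutFree t r := by
  refine ⟨fun h => ?_, fun h => .sup_le h.1 h.2⟩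
  generalize hx : LatTerm.sup s t = x at h
  induction h with
  | var i => cases hx
  | inf_left _ _ => cases hx
  | inf_right _ _ => cases hx
  | le_inf _ _ h₁ h₂ => exact ⟨.le_inf (h₁ hx).1 (h₂ hx).1, .le_inf (h₁ hx).2 (h₂ hx).2⟩
  | sup_left _ _ h => exact ⟨.sup_left _ (h hx).1, .sup_left _ (h hx).2⟩
  | sup_right _ _ h => exact ⟨.sup_right _ (h hx).1, .sup_right _ (h hx).2⟩
  | sup_le h₁ h₂ => cases hx; exact ⟨h₁, h₂⟩

theorem le_inf_iff {s t r : LatTerm X} : CutFree s (.inf t r) ↔ CutFree s t ∧ CutFree s r := by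
  refine ⟨fun h => ?_, fun h => .le_inf h.1 h.2⟩
  generalize hx : LatTerm.inf t r = x at h
  induction h with
  | var i => cases hx
  | inf_left _ _ h => exact ⟨.inf_left _ (h hx).1, .inf_left _ (h hx).2⟩
  | inf_right _ _ h => exact ⟨.inf_right _ (h hx).1, .inf_right _ (h hx).2⟩
  | le_inf h₁ h₂ => cases hx; exact ⟨h₁, h₂⟩
  | sup_left _ _ => cases hx
  | sup_right _ _ => cases hx
  | sup_le _ _ h₁ h₂ => exact ⟨.sup_le (h₁ hx).1 (h₂ hx).1, .sup_le (h₁ hx).2 (h₂ hx).2⟩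

/-- Cut elimination, by induction on the cut term and then on the derivations. -/
theorem trans {s t r : LatTerm X} (h : CutFree s t) (k : CutFree t r) : CutFree s r := by
  induction t generalizing s r with
  | var i =>
    generalize hx : LatTerm.var i = x at h
    induction h with
    | var j => cases hx; exact k
    | inf_left _ _ ih => exact .inf_left _ (ih hx)
    | inf_right _ _ ih => exact .inf_right _ (ih hx)
    | sup_le _ _ ih₁ ih₂ => exact .sup_le (ih₁ hx) (ih₂ hx)
    | le_inf => cases hx
    | sup_left => cases hx
    | sup_right => cases hx
  | inf t₁ t₂ ih₁ ih₂ =>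
    obtain ⟨h₁, h₂⟩ := le_inf_iff.mp h
    generalize hx : LatTerm.inf t₁ t₂ = x at k
    induction k with
    | var j => cases hx
    | inf_left _ k => cases hx; exact ih₁ h₁ k
    | inf_right _ k => cases hx; exact ih₂ h₂ k
    | le_inf _ _ j₁ j₂ => exact .le_inf (j₁ hx) (j₂ hx)
    | sup_left _ _ j => exact .sup_left _ (j hx)
    | sup_right _ _ j => exact .sup_right _ (j hx)
    | sup_le => cases hx
  | sup t₁ t₂ ih₁ ih₂ =>
    obtain ⟨k₁, k₂⟩ := sup_le_iff.mp k
    generalize hx : LatTerm.sup t₁ t₂ = x at h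
    induction h with
    | var j => cases hx
    | inf_left _ _ j => exact .inf_left _ (j hx)
    | inf_right _ _ j => exact .inf_right _ (j hx)
    | le_inf => cases hx
    | sup_left _ h => cases hx; exact ih₁ h k₁
    | sup_right _ h => cases hx; exact ih₂ h k₂
    | sup_le _ _ j₁ j₂ => exact .sup_le (j₁ hx) (j₂ hx)

theorem of_le {s t : LatTerm X} (h : LatTerm.Le s t) : CutFree s t := by
  induction h with
  | refl s => exact refl s
  | trans _ _ h k => exact h.trans k
  | inf_le_left s t => exact .inf_left _ (refl s)
  | inf_le_right s t => exact .inf_right _ (refl t)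
  | le_inf _ _ h k => exact .le_inf h k
  | le_sup_left s t => exact .sup_left _ (refl s)
  | le_sup_right s t => exact .sup_right _ (refl t)
  | sup_le _ _ h k => exact .sup_le h k

theorem le {s t : LatTerm X} (h : CutFree s t) : LatTerm.Le s t := by
  induction h with
  | var i => exact .refl _
  | inf_left _ _ h => exact .trans (.inf_le_left _ _) h
  | inf_right _ _ h => exact .trans (.inf_le_right _ _) h
  | le_inf _ _ h k => exact .le_inf h k
  | sup_left _ _ h => exact .trans h (.le_sup_left _ _)
  | sup_right _ _ h => exact .trans h (.le_sup_right _ _)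
  | sup_le _ _ h k => exact .sup_le h k

/-- The number of occurrences of variables and operations in a term. -/
def size : LatTerm X → ℕ
  | .var _ => 1
  | .inf s t => size s + size t + 1
  | .sup s t => size s + size t + 1

/-- Exhaustive search, to depth `n`, for a derivation in the cut-free calculus. -/
def search [DecidableEq X] : ℕ → LatTerm X → LatTerm X → Bool
  | 0, _, _ => false
  | n + 1, s, t =>
    (match s with
      | .var i => match t with
        | .var j => decide (i = j)
        | _ => false
      | .inf a b => search n a t || search n b t
      | .sup a b => search n a t && search n b t) ||
    (match t with
      | .var _ => false
      | .inf a b => search n s a && search n s b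
      | .sup a b => search n s a || search n s b)

theorem of_search [DecidableEq X] {n : ℕ} {s t : LatTerm X} (h : search n s t = true) :
    CutFree s t := by
  induction n generalizing s t with
  | zero => simp [search] at h
  | succ n ih =>
    unfold search at h
    rw [Bool.or_eq_true] at h
    rcases h with h | h
    · cases s with
      | var i =>
        cases t with
        | var j => rw [of_decide_eq_true h]; exact .var j
        | inf => simp at h
        | sup => simp at h
      | inf a b =>
        simp only [Bool.or_eq_true] at h
        exact h.elim (fun h => .inf_left _ (ih h)) (fun h => .inf_right _ (ih h))
      | sup a b =>
        simp only [Bool.and_eq_true] at h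
        exact .sup_le (ih h.1) (ih h.2)
    · cases t with
      | var i => simp at h
      | inf a b =>
        simp only [Bool.and_eq_true] at h
        exact .le_inf (ih h.1) (ih h.2)
      | sup a b =>
        simp only [Bool.or_eq_true] at h
        exact h.elim (fun h => .sup_left _ (ih h)) (fun h => .sup_right _ (ih h))

theorem search_eq_true [DecidableEq X] {s t : LatTerm X} (h : CutFree s t) :
    ∀ {n : ℕ}, size s + size t ≤ n → search n s t = true := by
  induction h with
  | var i =>
    rintro (_ | n) hn
    · simp [size] at hn
    · simp [search]
  | inf_left t _ ih | inf_right t _ ih =>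
    rintro (_ | n) hn
    · simp [size] at hn
    · simp [search, ih (n := n) (by simp only [size] at hn; omega)]
  | sup_left t _ ih | sup_right t _ ih =>
    rintro (_ | n) hn
    · simp [size] at hn
    · simp [search, ih (n := n) (by simp only [size] at hn; omega)]
  | le_inf _ _ ih₁ ih₂ | sup_le _ _ ih₁ ih₂ =>
    rintro (_ | n) hn
    · simp [size] at hn
    · simp [search, ih₁ (n := n) (by simp only [size] at hn; omega),
        ih₂ (n := n) (by simp only [size] at hn; omega)]

end CutFree

instance [DecidableEq X] (s t : LatTerm X) : Decidable (LatTerm.Le s t) :=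
  decidable_of_iff (CutFree.search (CutFree.size s + CutFree.size t) s t = true)
    ⟨fun h => (CutFree.of_search h).le, fun h => (CutFree.of_le h).search_eq_true le_rfl⟩

/-- The value of a lattice term under an assignment of its variables. -/
def eval {M : Type v} [Lattice M] (f : X → M) : LatTerm X → M
  | .var i => f i
  | .inf s t => eval f s ⊓ eval f t
  | .sup s t => eval f s ⊔ eval f t

theorem eval_mono {M : Type v} [Lattice M] (f : X → M) {s t : LatTerm X} (h : LatTerm.Le s t) :
    eval f s ≤ eval f t := by
  induction h with
  | refl s => exact le_rfl
  | trans _ _ h k => exact h.trans k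
  | inf_le_left s t => exact _root_.inf_le_left
  | inf_le_right s t => exact _root_.inf_le_right
  | le_inf _ _ h k => exact _root_.le_inf h k
  | le_sup_left s t => exact _root_.le_sup_left
  | le_sup_right s t => exact _root_.le_sup_right
  | sup_le _ _ h k => exact _root_.sup_le h k

end LatTerm

namespace FreeLat

variable {X : Type u} {Y : Type v}

/-- The free generators. -/
def var (i : X) : FreeLat X := mk (.var i)

/-- The word problem for free lattices is decidable. -/
instance [DecidableEq X] : DecidableLE (FreeLat X) := fun a b =>
  Quotient.recOnSubsingleton₂ a b fun s t => inferInstanceAs (Decidable (LatTerm.Le s t))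

@[elab_as_elim]
theorem induction {P : FreeLat X → Prop} (var : ∀ i, P (var i))
    (inf : ∀ a b, P a → P b → P (a ⊓ b)) (sup : ∀ a b, P a → P b → P (a ⊔ b)) (a : FreeLat X) :
    P a := by
  obtain ⟨s⟩ := a
  change P (mk s)
  induction s with
  | var i => exact var i
  | inf s t hs ht => exact inf _ _ hs ht
  | sup s t hs ht => exact sup _ _ hs ht

/-- The universal property of the free lattice. -/
def lift {M : Type v} [Lattice M] (f : X → M) : LatticeHom (FreeLat X) M where
  toFun := Quotient.lift (LatTerm.eval f) fun _ _ h =>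
    le_antisymm (LatTerm.eval_mono f h.1) (LatTerm.eval_mono f h.2)
  map_sup' := by rintro ⟨s⟩ ⟨t⟩; rfl
  map_inf' := by rintro ⟨s⟩ ⟨t⟩; rfl

@[simp]
theorem lift_var {M : Type v} [Lattice M] (f : X → M) (i : X) : lift f (var i) = f i := rfl

/-- Whitman's condition (W). -/
theorem inf_le_sup_iff {a b c d : FreeLat X} : a ⊓ b ≤ c ⊔ d ↔
    a ≤ c ⊔ d ∨ b ≤ c ⊔ d ∨ a ⊓ b ≤ c ∨ a ⊓ b ≤ d := by
  constructor
  · obtain ⟨a⟩ := a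
    obtain ⟨b⟩ := b
    obtain ⟨c⟩ := c
    obtain ⟨d⟩ := d
    intro h
    have h' : LatTerm.CutFree (.inf a b) (.sup c d) := .of_le h
    cases h' with
    | inf_left _ h => exact .inl h.le
    | inf_right _ h => exact .inr (.inl h.le)
    | sup_left _ h => exact .inr (.inr (.inl h.le))
    | sup_right _ h => exact .inr (.inr (.inr h.le))
  · rintro (h | h | h | h)
    · exact inf_le_left.trans h
    · exact inf_le_right.trans h
    · exact h.trans le_sup_left
    · exact h.trans le_sup_right

/-! ### Embeddings between free lattices -/

/-- A family of elements of a lattice is independent if no member lies in the ideal generated by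
the other members, nor in the filter generated by them.
Ideals and filters are given by their membership predicates, and instead of the generated one, any
ideal (filter) that contains the other members and omits the given one will do. -/
structure IsIndependent {L : Type w} [Lattice L] (f : X → L) : Prop where
  ideal : ∀ i, ∃ P : L → Prop, (∀ a b, P b → a ≤ b → P a) ∧ (∀ a b, P a → P b → P (a ⊔ b)) ∧
    (∀ j, j ≠ i → P (f j)) ∧ ¬ P (f i)
  filter : ∀ i, ∃ P : L → Prop, (∀ a b, P a → a ≤ b → P b) ∧ (∀ a b, P a → P b → P (a ⊓ b)) ∧
    (∀ j, j ≠ i → P (f j)) ∧ ¬ P (f i)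

namespace IsIndependent

/-- Independence may be tested in the images under homomorphisms that depend on the member that is
singled out. -/
theorem of_hom {L : Type w} [Lattice L] {f : X → L}
    (ideal : ∀ i, ∃ (M : Type w) (_ : Lattice M) (h : LatticeHom L M) (u : M),
      (∀ j, j ≠ i → h (f j) ≤ u) ∧ ¬ h (f i) ≤ u)
    (filter : ∀ i, ∃ (M : Type w) (_ : Lattice M) (h : LatticeHom L M) (l : M),
      (∀ j, j ≠ i → l ≤ h (f j)) ∧ ¬ l ≤ h (f i)) : IsIndependent f where
  ideal i := by
    obtain ⟨M, _, h, u, hj, hi⟩ := ideal i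
    exact ⟨fun a => h a ≤ u, fun a b hb hab => (OrderHomClass.mono h hab).trans hb,
      fun a b ha hb => (map_sup h a b).trans_le (sup_le ha hb), hj, hi⟩
  filter i := by
    obtain ⟨M, _, h, l, hj, hi⟩ := filter i
    exact ⟨fun a => l ≤ h a, fun a b ha hab => ha.trans (OrderHomClass.mono h hab),
      fun a b ha hb => (le_inf ha hb).trans_eq (map_inf h a b).symm, hj, hi⟩

variable {f : X → FreeLat Y}

/-- Each `f i` is join-prime in the sublattice generated by an independent family, because every
element of that sublattice lies above `f i` or in the ideal that separates `f i` from the other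
members. -/
theorem le_lift_sup (hf : IsIndependent f) {i : X} {a b : FreeLat X} (h : f i ≤ lift f (a ⊔ b)) :
    f i ≤ lift f a ∨ f i ≤ lift f b := by
  obtain ⟨P, hle, hsup, hP, hPi⟩ := hf.ideal i
  have key : ∀ a : FreeLat X, f i ≤ lift f a ∨ P (lift f a) := by
    intro a
    induction a using FreeLat.induction with
    | var j =>
      by_cases hj : j = i
      · exact .inl (by rw [lift_var, hj])
      · exact .inr (hP j hj)
    | inf a b ha hb =>
      rw [map_inf]
      rcases ha with ha | ha
      · rcases hb with hb | hb
        · exact .inl (le_inf ha hb)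
        · exact .inr (hle _ _ hb inf_le_right)
      · exact .inr (hle _ _ ha inf_le_left)
    | sup a b ha hb =>
      rw [map_sup]
      rcases ha with ha | ha
      · exact .inl (ha.trans le_sup_left)
      · rcases hb with hb | hb
        · exact .inl (hb.trans le_sup_right)
        · exact .inr (hsup _ _ ha hb)
  rw [map_sup] at h
  rcases key a with ha | ha
  · exact .inl ha
  · rcases key b with hb | hb
    · exact .inr hb
    · exact absurd (hle _ _ (hsup _ _ ha hb) h) hPi

/-- The dual of `le_lift_sup`. -/
theorem lift_inf_le (hf : IsIndependent f) {i : X} {a b : FreeLat X} (h : lift f (a ⊓ b) ≤ f i) :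
    lift f a ≤ f i ∨ lift f b ≤ f i := by
  obtain ⟨P, hle, hinf, hP, hPi⟩ := hf.filter i
  have key : ∀ a : FreeLat X, lift f a ≤ f i ∨ P (lift f a) := by
    intro a
    induction a using FreeLat.induction with
    | var j =>
      by_cases hj : j = i
      · exact .inl (by rw [lift_var, hj])
      · exact .inr (hP j hj)
    | inf a b ha hb =>
      rw [map_inf]
      rcases ha with ha | ha
      · exact .inl (inf_le_left.trans ha)
      · rcases hb with hb | hb
        · exact .inl (inf_le_right.trans hb)
        · exact .inr (hinf _ _ ha hb)
    | sup a b ha hb =>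
      rw [map_sup]
      rcases ha with ha | ha
      · rcases hb with hb | hb
        · exact .inl (sup_le ha hb)
        · exact .inr (hle _ _ hb le_sup_right)
      · exact .inr (hle _ _ ha le_sup_left)
  rw [map_inf] at h
  rcases key a with ha | ha
  · exact .inl ha
  · rcases key b with hb | hb
    · exact .inr hb
    · exact absurd (hle _ _ (hinf _ _ ha hb) h) hPi

/-- In a lattice satisfying Whitman's condition, such as a free lattice, an independent family
generates a free sublattice. -/
theorem le_of_lift_le (hf : IsIndependent f) {a b : FreeLat X} (h : lift f a ≤ lift f b) :
    a ≤ b := by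
  induction a using FreeLat.induction generalizing b with
  | sup a₁ a₂ h₁ h₂ =>
    rw [map_sup] at h
    exact sup_le (h₁ (le_sup_left.trans h)) (h₂ (le_sup_right.trans h))
  | var i =>
    induction b using FreeLat.induction with
    | var j =>
      by_cases hj : j = i
      · rw [hj]
      · obtain ⟨P, hle, -, hP, hPi⟩ := hf.ideal i
        exact absurd (hle _ _ (hP j hj) h) hPi
    | inf b₁ b₂ h₁ h₂ =>
      rw [map_inf] at h
      exact le_inf (h₁ (h.trans inf_le_left)) (h₂ (h.trans inf_le_right))
    | sup b₁ b₂ h₁ h₂ =>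
      rcases hf.le_lift_sup h with h | h
      · exact (h₁ h).trans le_sup_left
      · exact (h₂ h).trans le_sup_right
  | inf a₁ a₂ h₁ h₂ =>
    induction b using FreeLat.induction with
    | var j =>
      rcases hf.lift_inf_le h with h | h
      · exact inf_le_left.trans (h₁ h)
      · exact inf_le_right.trans (h₂ h)
    | inf b₁ b₂ k₁ k₂ =>
      rw [map_inf (lift f) b₁] at h
      exact le_inf (k₁ (h.trans inf_le_left)) (k₂ (h.trans inf_le_right))
    | sup b₁ b₂ k₁ k₂ =>
      have h' := h
      rw [map_inf, map_sup] at h'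
      rcases inf_le_sup_iff.mp h' with h' | h' | h' | h'
      · exact inf_le_left.trans (h₁ (h'.trans_eq (map_sup _ _ _).symm))
      · exact inf_le_right.trans (h₂ (h'.trans_eq (map_sup _ _ _).symm))
      · exact (k₁ ((map_inf _ _ _).trans_le h')).trans le_sup_left
      · exact (k₂ ((map_inf _ _ _).trans_le h')).trans le_sup_right

end IsIndependent

theorem isIndependent_var_comp {g : X → Y} (hg : Function.Injective g) :
    IsIndependent fun i => var (g i) := by
  refine .of_hom (fun i => ?_) fun i => ?_
  · refine ⟨ULift Prop, inferInstance, lift fun y => ⟨y = g i⟩, ⟨False⟩, fun j hj => ?_, ?_⟩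
    · exact fun h => hj (hg h)
    · exact fun h => h rfl
  · refine ⟨ULift Prop, inferInstance, lift fun y => ⟨y ≠ g i⟩, ⟨True⟩, fun j hj => ?_, ?_⟩
    · exact fun _ h => hj (hg h)
    · exact fun h => h trivial rfl

/-- Four elements of a lattice, as functions of three of its elements. On the generators of `F(3)`
they form an independent family. -/
def four {L : Type w} [Lattice L] (x y z : L) : Fin 4 → L :=
  ![x ⊔ y ⊓ z, y ⊓ (x ⊔ z), x ⊓ (y ⊔ z) ⊔ z ⊓ (x ⊔ y), (y ⊔ x ⊓ z) ⊓ (z ⊔ x ⊓ y)]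

theorem map_four {L : Type w} {M : Type v} [Lattice L] [Lattice M] (f : LatticeHom L M) (x y z : L)
    (i : Fin 4) : f (four x y z i) = four (f x) (f y) (f z) i := by
  fin_cases i <;> simp [four]

theorem four_up {L : Type w} [Lattice L] (x y z : L) (i : Fin 4) :
    four (ULift.up.{v} x) (ULift.up y) (ULift.up z) i = ULift.up (four x y z i) := by
  fin_cases i <;> rfl

/-- On the generators of `F(3)`, no member of `four` lies below the join of the other ones. -/
theorem exists_four_le_and_not_le (i : Fin 4) :
    ∃ u : F3, (∀ j, j ≠ i → four (var 0) (var 1) (var 2) j ≤ u) ∧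
      ¬ four (var 0) (var 1) (var 2) i ≤ u := by
  -- For each `i`, a common upper bound of the three elements other than the `i`-th.
  let u (x y z : F3) : Fin 4 → F3 := ![y ⊔ z, x ⊔ (x ⊔ y) ⊓ (z ⊔ x ⊓ y),
    x ⊔ (x ⊔ z) ⊓ (y ⊔ x ⊓ z), x ⊔ (y ⊓ (x ⊔ z) ⊔ z ⊓ (x ⊔ y))]
  exact ⟨u (var 0) (var 1) (var 2) i, by revert i; decide +kernel⟩

/-- On the generators of `F(3)`, no member of `four` lies above the meet of the other ones. -/
theorem exists_le_four_and_not_le (i : Fin 4) :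
    ∃ l : F3, (∀ j, j ≠ i → l ≤ four (var 0) (var 1) (var 2) j) ∧
      ¬ l ≤ four (var 0) (var 1) (var 2) i := by
  -- Exchanging `x` and `y` in the dual terms permutes the four elements; these are the bounds that
  -- result from the ones for joins.
  let l (x y z : F3) : Fin 4 → F3 := ![y ⊓ (x ⊓ y ⊔ z ⊓ (x ⊔ y)), x ⊓ z,
    y ⊓ ((x ⊔ y ⊓ z) ⊓ (z ⊔ x ⊓ y)), y ⊓ (y ⊓ z ⊔ x ⊓ (y ⊔ z))]
  exact ⟨l (var 0) (var 1) (var 2) i, by revert i; decide +kernel⟩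

theorem le_sup_vars (a : F3) : a ≤ var 0 ⊔ var 1 ⊔ var 2 := by
  induction a using FreeLat.induction with
  | var i =>
    fin_cases i
    · exact le_sup_left.trans le_sup_left
    · exact le_sup_right.trans le_sup_left
    · exact le_sup_right
  | inf a b ha _ => exact inf_le_left.trans ha
  | sup a b ha hb => exact sup_le ha hb

/-- Replacing the three generators in `Fin 3` by the four elements `four` preserves independence of
the generators. Hence the free lattice on `4 + Y` embeds into the free lattice on `3 + Y`. -/
theorem isIndependent_sum_elim_four (Y : Type u) :
    IsIndependent (Sum.elim (four (var (.inl 0)) (var (.inl 1)) (var (.inl 2)))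
      fun y => var (.inr y) : Fin 4 ⊕ Y → FreeLat (Fin 3 ⊕ Y)) := by
  refine .of_hom ?_ ?_
  · rintro (i | y)
    · obtain ⟨u, hu, hi⟩ := exists_four_le_and_not_le i
      refine ⟨ULift F3, inferInstance, lift (Sum.elim (fun i => ⟨var i⟩) fun _ => ⟨⊥⟩), ⟨u⟩, ?_, ?_⟩
      · rintro (j | y) hj
        · have := hu j fun e => hj (by rw [e])
          simpa [map_four, four_up] using this
        · exact bot_le (a := u)
      · simpa [map_four, four_up] using hi
    · refine ⟨ULift Prop, inferInstance, lift fun x => ⟨x = .inr y⟩, ⟨False⟩, ?_, ?_⟩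
      · rintro (j | y') hj
        · fin_cases j <;> simp [four]
        · exact fun h => hj (congrArg _ (Sum.inr_injective h))
      · exact fun h => h rfl
  · rintro (i | y)
    · obtain ⟨l, hl, hi⟩ := exists_le_four_and_not_le i
      refine ⟨ULift F3, inferInstance, lift (Sum.elim (fun i => ⟨var i⟩)
        fun _ => ⟨var 0 ⊔ var 1 ⊔ var 2⟩), ⟨l⟩, ?_, ?_⟩
      · rintro (j | y) hj
        · have := hl j fun e => hj (by rw [e])
          simpa [map_four, four_up] using this
        · exact le_sup_vars l
      · simpa [map_four, four_up] using hi
    · refine ⟨ULift Prop, inferInstance, lift fun x => ⟨x ≠ .inr y⟩, ⟨True⟩, ?_, ?_⟩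
      · rintro (j | y') hj
        · fin_cases j <;> simp [four]
        · exact fun _ h => hj (congrArg _ (Sum.inr_injective h))
      · exact fun h => h trivial rfl

/-- Whitman's theorem that `F(3)` contains every finitely generated free lattice. By induction on
`X`, the free lattice on `3 + X` embeds into `F(3)`, with one generator gained at each step by
`isIndependent_sum_elim_four`. -/
theorem exists_embedding_F3 (X : Type u) [Finite X] :
    ∃ f : LatticeHom (FreeLat X) F3, ∀ a b, f a ≤ f b → a ≤ b := by
  have key : ∃ f : LatticeHom (FreeLat (Fin 3 ⊕ X)) F3, ∀ a b, f a ≤ f b → a ≤ b := by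
    induction X using Finite.induction_empty_option with
    | of_equiv e h =>
      obtain ⟨f, hf⟩ := h
      have hi := isIndependent_var_comp ((Equiv.refl (Fin 3)).sumCongr e.symm).injective
      exact ⟨f.comp (lift _), fun a b h => hi.le_of_lift_le (hf _ _ h)⟩
    | h_empty =>
      have hi := isIndependent_var_comp (Equiv.sumEmpty (Fin 3) PEmpty).injective
      exact ⟨lift _, fun a b h => hi.le_of_lift_le h⟩
    | h_option h =>
      rename_i Y _
      obtain ⟨f, hf⟩ := h
      let g : Fin 3 ⊕ Option Y → Fin 4 ⊕ Y :=
        Sum.elim (fun i => .inl i.castSucc) (Option.elim · (.inl (Fin.last 3)) .inr)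
      have hg : Function.Injective g := by
        rintro (i | _ | y) (j | _ | y') h
        all_goals simp_all [g, Fin.ext_iff]
        all_goals omega
      have hi := isIndependent_var_comp hg
      have hi' := isIndependent_sum_elim_four Y
      exact ⟨f.comp ((lift _).comp (lift _)),
        fun a b h => hi.le_of_lift_le (hi'.le_of_lift_le (hf _ _ h))⟩
  obtain ⟨f, hf⟩ := key
  have hi := isIndependent_var_comp (Sum.inr_injective (α := Fin 3) (β := X))
  exact ⟨f.comp (lift _), fun a b h => hi.le_of_lift_le (hf _ _ h)⟩

end FreeLat

/-! ### Minimal pairs and condition (T) -/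

section MinimalPairs

variable {S : Type u} [SemilatticeSup S]

/-- The set of join-irreducible elements below `a`. -/
noncomputable def below [Finite S] (a : S) : Finset (JoinIrr S) :=
  (Set.toFinite {q | q.1 ≤ a}).toFinset

@[simp]
theorem mem_below [Finite S] {a : S} {q : JoinIrr S} : q ∈ below a ↔ q.1 ≤ a := by simp [below]

variable [OrderBot S]

theorem bigJoin_le_iff {I : Finset (JoinIrr S)} {a : S} : bigJoin I ≤ a ↔ ∀ i ∈ I, i.1 ≤ a :=
  Finset.sup_le_iff

theorem le_bigJoin {I : Finset (JoinIrr S)} {i : JoinIrr S} (hi : i ∈ I) : i.1 ≤ bigJoin I :=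
  Finset.le_sup (f := Subtype.val) hi

theorem joinIrr_ne_bot (p : JoinIrr S) : p.1 ≠ ⊥ := p.2.ne_bot

theorem mem_of_val_eq_bigJoin {p : JoinIrr S} {I : Finset (JoinIrr S)} (h : p.1 = bigJoin I) :
    p ∈ I := by
  obtain ⟨i, hi, e⟩ := p.2.finset_sup_eq h.symm
  rwa [← Subtype.ext e]

/-- `p` depends on `j` if `j` belongs to the second entry of a minimal pair whose first entry is
`p`. Condition (T) says that this relation has no cycles. -/
def Depends (p j : JoinIrr S) : Prop := ∃ I, IsMinimalPair p I ∧ j ∈ I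

theorem Dominated.bigJoin_le {X Y : Finset (JoinIrr S)} (h : Dominated X Y) :
    bigJoin X ≤ bigJoin Y :=
  bigJoin_le_iff.mpr fun x hx => by
    obtain ⟨y, hy, hxy⟩ := h x hx
    exact le_trans hxy (le_bigJoin hy)

/-- The second entry of a minimal pair is an antichain. -/
theorem IsMinimalPair.eq_of_le {p i j : JoinIrr S} {I : Finset (JoinIrr S)}
    (h : IsMinimalPair p I) (hi : i ∈ I) (hj : j ∈ I) (hij : i ≤ j) : i = j := by
  classical
  by_contra hne
  have hle : p.1 ≤ bigJoin (I.erase i) := h.le_join.trans <| bigJoin_le_iff.mpr fun k hk => by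
    by_cases hki : k = i
    · subst hki
      exact le_trans hij (le_bigJoin (Finset.mem_erase.mpr ⟨Ne.symm hne, hj⟩))
    · exact le_bigJoin (Finset.mem_erase.mpr ⟨hki, hk⟩)
  exact Finset.notMem_erase i I <|
    h.minimal _ (fun x hx => ⟨x, Finset.mem_of_mem_erase hx, le_rfl⟩) hle hi

variable [Finite S]

@[simp]
theorem bigJoin_below (a : S) : bigJoin (below a) = a := by
  refine le_antisymm (bigJoin_le_iff.mpr fun i hi => mem_below.mp hi) ?_
  obtain ⟨s, hs, hirr⟩ := exists_supIrred_decomposition a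
  rw [← hs]
  exact Finset.sup_le fun b hb =>
    le_bigJoin (i := ⟨b, hirr hb⟩) (mem_below.mpr (hs ▸ Finset.le_sup (f := id) hb))

theorem le_of_forall_joinIrr {a b : S} (h : ∀ p : JoinIrr S, p.1 ≤ a → p.1 ≤ b) : a ≤ b := by
  rw [← bigJoin_below a]
  exact bigJoin_le_iff.mpr fun i hi => h i (mem_below.mp hi)

/-- Every nontrivial cover of `p` by join-irreducible elements refines to a minimal pair. -/
theorem exists_isMinimalPair {p : JoinIrr S} {X : Finset (JoinIrr S)} (hp : p.1 ≤ bigJoin X)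
    (hX : ∀ x ∈ X, ¬ p ≤ x) : ∃ I, IsMinimalPair p I ∧ Dominated I X := by
  classical
  have := Fintype.ofFinite (JoinIrr S)
  -- A minimal set `D` among those that are dominated by `X`, closed downward, and cover `p`.
  let D₀ : Finset (JoinIrr S) := Finset.univ.filter fun q => ∃ x ∈ X, q ≤ x
  let F : Set (Finset (JoinIrr S)) :=
    {D | Dominated D X ∧ (∀ a b, a ≤ b → b ∈ D → a ∈ D) ∧ p.1 ≤ bigJoin D}
  have hF : F.Nonempty := by
    refine ⟨D₀, fun q hq => by simpa [D₀] using hq, fun a b hab hb => ?_, hp.trans ?_⟩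
    · obtain ⟨x, hx, hbx⟩ : ∃ x ∈ X, b ≤ x := by simpa [D₀] using hb
      exact Finset.mem_filter.mpr ⟨Finset.mem_univ _, x, hx, hab.trans hbx⟩
    · exact bigJoin_le_iff.mpr fun x hx =>
        le_bigJoin (Finset.mem_filter.mpr ⟨Finset.mem_univ _, x, hx, le_rfl⟩)
  obtain ⟨D, ⟨hDX, hDlow, hpD⟩, hmin⟩ := (Set.toFinite F).exists_minimal hF
  -- The maximal elements of `D` form the desired minimal pair with `p`.
  let I := D.filter fun q => ∀ d ∈ D, q ≤ d → q = d
  have hDI : Dominated D I := fun d hd => by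
    obtain ⟨m, hdm, hm⟩ := D.exists_le_maximal hd
    exact ⟨m, Finset.mem_filter.mpr ⟨hm.1, fun e he hme => le_antisymm hme (hm.2 he hme)⟩, hdm⟩
  have hID : I ⊆ D := Finset.filter_subset _ _
  have hpD' : p ∉ D := fun h => by
    obtain ⟨x, hx, hpx⟩ := hDX p h
    exact hX x hx hpx
  have hpI : p.1 ≤ bigJoin I := hpD.trans hDI.bigJoin_le
  have hminI : ∀ J, Dominated J I → p.1 ≤ bigJoin J → I ⊆ J := by
    intro J hJ hpJ i hi
    have hJD : (Finset.univ.filter fun q => ∃ x ∈ J, q ≤ x) ⊆ D := by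
      intro q hq
      obtain ⟨x, hx, hqx⟩ := (Finset.mem_filter.mp hq).2
      obtain ⟨y, hy, hxy⟩ := hJ x hx
      exact hDlow q y (hqx.trans hxy) (hID hy)
    have hle := hmin (y := Finset.univ.filter fun q => ∃ x ∈ J, q ≤ x)
      ⟨fun q hq => hDX q (hJD hq), fun a b hab hb => ?_, ?_⟩ hJD
    · obtain ⟨x, hx, hix⟩ := (Finset.mem_filter.mp (hle (hID hi))).2
      obtain ⟨y, hy, hxy⟩ := hJ x hx
      have hiy := (Finset.mem_filter.mp hi).2 y (hID hy) (hix.trans hxy)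
      rwa [le_antisymm hix (hiy ▸ hxy)]
    · obtain ⟨x, hx, hbx⟩ := (Finset.mem_filter.mp hb).2
      exact Finset.mem_filter.mpr ⟨Finset.mem_univ _, x, hx, hab.trans hbx⟩
    · exact hpJ.trans <| bigJoin_le_iff.mpr fun x hx =>
        le_bigJoin (Finset.mem_filter.mpr ⟨Finset.mem_univ _, x, hx, le_rfl⟩)
  refine ⟨I, ⟨?_, fun h => hpD' (hID h), hpI, hminI⟩, fun i hi => hDX i (hID hi)⟩
  by_contra hcard
  have hcard' : I.card ≤ 1 := by omega
  have : Nonempty (JoinIrr S) := ⟨p⟩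
  rcases Finset.card_le_one_iff_subset_singleton.mp hcard' with ⟨x, hx⟩
  have hpx : p.1 ≤ x.1 := hpI.trans (bigJoin_le_iff.mpr fun i hi => by
    rw [Finset.mem_singleton.mp (hx hi)])
  rcases I.eq_empty_or_nonempty with h | ⟨i, hi⟩
  · rw [h] at hpI
    exact joinIrr_ne_bot p (le_bot_iff.mp hpI)
  · have hxi : i = x := Finset.mem_singleton.mp (hx hi)
    exact hpD' (hDlow p i (hxi ▸ hpx) (hID hi))

/-- Refinement of the cover of `p` by the join-irreducible elements below `a` or below `b`. -/
theorem exists_isMinimalPair_of_le_sup {p : JoinIrr S} {a b : S} (hp : p.1 ≤ a ⊔ b)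
    (ha : ¬ p.1 ≤ a) (hb : ¬ p.1 ≤ b) :
    ∃ I, IsMinimalPair p I ∧ ∀ j ∈ I, j.1 ≤ a ∨ j.1 ≤ b := by
  classical
  have hX : bigJoin (below a ∪ below b) = a ⊔ b := by
    rw [show bigJoin (below a ∪ below b) = bigJoin (below a) ⊔ bigJoin (below b) from
      Finset.sup_union, bigJoin_below, bigJoin_below]
  obtain ⟨I, hI, hIX⟩ := exists_isMinimalPair (hp.trans_eq hX.symm) fun q hq hpq => by
    rcases Finset.mem_union.mp hq with h | h
    · exact ha (le_trans hpq (mem_below.mp h))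
    · exact hb (le_trans hpq (mem_below.mp h))
  refine ⟨I, hI, fun j hj => ?_⟩
  obtain ⟨q, hq, hjq⟩ := hIX j hj
  rcases Finset.mem_union.mp hq with h | h
  · exact .inl (le_trans hjq (mem_below.mp h))
  · exact .inr (le_trans hjq (mem_below.mp h))

/-- The join of all join-irreducible elements, other than `j`, that lie below some member of
`I`. For a minimal pair `⟨p, I⟩` with `j ∈ I`, this just fails to contain `p`. -/
noncomputable def truncJoin (I : Finset (JoinIrr S)) (j : JoinIrr S) : S :=
  bigJoin (Set.toFinite {q | q ≠ j ∧ ∃ i ∈ I, q ≤ i}).toFinset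

theorem le_truncJoin {I : Finset (JoinIrr S)} {q i j : JoinIrr S} (hi : i ∈ I) (hqi : q ≤ i)
    (hqj : q ≠ j) : q.1 ≤ truncJoin I j :=
  le_bigJoin ((Set.Finite.mem_toFinset _).mpr ⟨hqj, i, hi, hqi⟩)

theorem truncJoin_le (I : Finset (JoinIrr S)) (j : JoinIrr S) : truncJoin I j ≤ bigJoin I :=
  Dominated.bigJoin_le fun _ hq => ((Set.Finite.mem_toFinset _).mp hq).2

theorem IsMinimalPair.not_le_truncJoin {p j : JoinIrr S} {I : Finset (JoinIrr S)}
    (h : IsMinimalPair p I) (hj : j ∈ I) : ¬ p.1 ≤ truncJoin I j := fun hle => by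
  have := h.minimal _ (fun q hq => ((Set.Finite.mem_toFinset _).mp hq).2) hle hj
  exact ((Set.Finite.mem_toFinset _).mp this).1 rfl

theorem IsMinimalPair.not_le_truncJoin_of_mem {p j : JoinIrr S} {I : Finset (JoinIrr S)}
    (h : IsMinimalPair p I) (hj : j ∈ I) : ¬ j.1 ≤ truncJoin I j := fun hle =>
  h.not_le_truncJoin hj <| h.le_join.trans <| bigJoin_le_iff.mpr fun i hi => by
    by_cases hij : i = j
    · rwa [hij]
    · exact le_truncJoin hi le_rfl hij

/-- On a finite set, the reflexive transitive closure of a well-founded relation is a partial order,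
and it extends to a linear one. -/
theorem conditionT_iff_wellFounded :
    ConditionT S ↔ WellFounded (Depends : JoinIrr S → JoinIrr S → Prop) := by
  constructor
  · rintro ⟨r, hr, h⟩
    have hwf : WellFounded fun p j => r p j ∧ p ≠ j := by
      have : IsTrans (JoinIrr S) fun p j => r p j ∧ p ≠ j := ⟨fun a b c hab hbc =>
        ⟨hr.trans _ _ _ hab.1 hbc.1, fun hac =>
          hab.2 (hr.antisymm _ _ hab.1 (hac ▸ hbc.1))⟩⟩
      have : Std.Irrefl fun p j : JoinIrr S => r p j ∧ p ≠ j := ⟨fun a h => h.2 rfl⟩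
      exact Finite.wellFounded_of_trans_of_irrefl _
    refine Subrelation.wf ?_ hwf
    rintro p j ⟨I, hI, hj⟩
    exact ⟨h p I hI j hj, fun e => hI.notMem (e ▸ hj)⟩
  · intro hwf
    have hpo : IsPartialOrder (JoinIrr S) (Relation.ReflTransGen Depends) :=
      { refl := fun _ => .refl
        trans := fun _ _ _ => Relation.ReflTransGen.trans
        antisymm := fun a b hab hba => by
          rcases Relation.reflTransGen_iff_eq_or_transGen.mp hab with h | h
          · exact h.symm
          · exact absurd (h.trans_left hba) (hwf.transGen.irrefl.irrefl a) }
    obtain ⟨s, hs, hle⟩ := extend_partialOrder (Relation.ReflTransGen (Depends (S := S)))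
    exact ⟨s, hs, fun p I hI j hj => hle _ _ (.single ⟨I, hI, hj⟩)⟩

end MinimalPairs

/-! ### Join embeddings -/

section JoinEmbedding

variable {S : Type u} [SemilatticeSup S] {T : Type v} [PartialOrder T] {f : S → T}

theorem IsJoinEmbedding.le_iff_le (hf : IsJoinEmbedding f) {a b : S} : f a ≤ f b ↔ a ≤ b := by
  constructor
  · intro h
    have h₁ : IsLUB {f a, f b} (f b) :=
      ⟨by rintro _ (rfl | rfl); exacts [h, le_rfl], fun c hc => hc (by simp)⟩
    exact sup_eq_right.mp (hf.1 ((hf.2 a b).unique h₁))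
  · intro h
    have := (hf.2 a b).1 (show f a ∈ {f a, f b} by simp)
    rwa [sup_eq_right.mpr h] at this

theorem IsJoinEmbedding.apply_bigJoin_le [OrderBot S] (hf : IsJoinEmbedding f)
    {I : Finset (JoinIrr S)} (hI : I.Nonempty) {c : T} (h : ∀ i ∈ I, f i.1 ≤ c) :
    f (bigJoin I) ≤ c := by
  induction hI using Finset.Nonempty.cons_induction with
  | singleton i => simpa [bigJoin] using h i (by simp)
  | cons i I hi _ ih =>
    rw [show bigJoin (Finset.cons i I hi) = i.1 ⊔ bigJoin I from Finset.sup_cons hi]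
    refine (hf.2 _ _).2 ?_
    rintro _ (rfl | rfl)
    · exact h i (by simp)
    · exact ih fun j hj => h j (by simp [hj])

end JoinEmbedding

/-! ### Condition (T) implies sharp transferability -/

section Transfer

variable {S : Type u} [SemilatticeSup S] {L : Type v} [SemilatticeSup L] {φ : S → Order.Ideal L}

/-- The join in `Id L` of the ideals `φ a` and `φ b` consists of the elements below some `y ⊔ z`
with `y ∈ φ a`, `z ∈ φ b`. Since `L` need not have a zero, Mathlib has no join of ideals here, so the
ideal is built by hand. -/
theorem exists_le_sup_of_mem_ideal (hφ : IsJoinEmbedding φ) {a b : S} {x : L}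
    (hx : x ∈ φ (a ⊔ b)) : ∃ y ∈ φ a, ∃ z ∈ φ b, x ≤ y ⊔ z := by
  let K : Order.Ideal L :=
    { carrier := {x | ∃ y ∈ φ a, ∃ z ∈ φ b, x ≤ y ⊔ z}
      lower' := by
        rintro x x' hx' ⟨y, hy, z, hz, h⟩
        exact ⟨y, hy, z, hz, hx'.trans h⟩
      nonempty' := by
        obtain ⟨y, hy⟩ := (φ a).nonempty
        obtain ⟨z, hz⟩ := (φ b).nonempty
        exact ⟨y ⊔ z, y, hy, z, hz, le_rfl⟩
      directed' := by
        rintro x ⟨y, hy, z, hz, h⟩ x' ⟨y', hy', z', hz', h'⟩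
        exact ⟨x ⊔ x', ⟨y ⊔ y', Order.Ideal.sup_mem hy hy', z ⊔ z', Order.Ideal.sup_mem hz hz',
          (sup_le_sup h h').trans (sup_sup_sup_comm _ _ _ _).le⟩, le_sup_left, le_sup_right⟩ }
  have hK : K ∈ upperBounds {φ a, φ b} := by
    rintro _ (rfl | rfl) x hx
    · obtain ⟨z, hz⟩ := (φ b).nonempty
      exact ⟨x, hx, z, hz, le_sup_left⟩
    · obtain ⟨y, hy⟩ := (φ a).nonempty
      exact ⟨y, hy, x, hx, le_sup_right⟩
  exact (hφ.2 a b).2 hK hx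

variable [OrderBot S]

theorem exists_family_of_mem_ideal (hφ : IsJoinEmbedding φ) {I : Finset (JoinIrr S)}
    (hI : I.Nonempty) {x : L} (hx : x ∈ φ (bigJoin I)) :
    ∃ y : JoinIrr S → L, (∀ j ∈ I, y j ∈ φ j.1) ∧ ∀ b, (∀ j ∈ I, y j ≤ b) → x ≤ b := by
  classical
  induction hI using Finset.Nonempty.cons_induction generalizing x with
  | singleton i => exact ⟨fun _ => x, by simpa [bigJoin] using hx, by simp⟩
  | cons i I hi _ ih =>
    rw [show bigJoin (Finset.cons i I hi) = i.1 ⊔ bigJoin I from Finset.sup_cons hi] at hx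
    obtain ⟨y, hy, z, hz, hxyz⟩ := exists_le_sup_of_mem_ideal hφ hx
    obtain ⟨g, hg, hgz⟩ := ih hz
    refine ⟨Function.update g i y, fun j hj => ?_, fun b hb => hxyz.trans (sup_le ?_ ?_)⟩
    · by_cases hji : j = i
      · subst hji
        simpa using hy
      · simpa [hji] using hg j (by simpa [hji] using hj)
    · simpa using hb i (by simp)
    · refine hgz b fun j hj => ?_
      have hji : j ≠ i := fun e => hi (e ▸ hj)
      simpa [hji] using hb j (by simp [hj])

theorem exists_upperBound_mem_ideal {K : Order.Ideal L} {s : Set L} (hs : s.Finite)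
    (hsK : ∀ x ∈ s, x ∈ K) : ∃ u ∈ K, ∀ x ∈ s, x ≤ u := by
  induction s, hs using Set.Finite.induction_on with
  | empty =>
    obtain ⟨u, hu⟩ := K.nonempty
    exact ⟨u, hu, by simp⟩
  | @insert a s _ _ ih =>
    obtain ⟨u, hu, h⟩ := ih fun x hx => hsK x (.inr hx)
    refine ⟨a ⊔ u, Order.Ideal.sup_mem (hsK a (.inl rfl)) hu, ?_⟩
    rintro x (rfl | hx)
    · exact le_sup_left
    · exact (h x hx).trans le_sup_right

variable [Finite S]

/-- The values on the join-irreducible elements of a join embedding into `L`. They are chosen by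
recursion along `Depends`: the value at `j` is taken so large that it takes part in covering the
values at all `p` with a minimal pair `⟨p, I⟩`, `j ∈ I`. -/
theorem exists_joinIrr_lift (hwf : WellFounded (Depends (S := S))) (hφ : IsJoinEmbedding φ) :
    ∃ η : JoinIrr S → L, (∀ p, η p ∈ φ p.1) ∧ (∀ p a, η p ∈ φ a → p.1 ≤ a) ∧
      ∀ p I, IsMinimalPair p I → ∀ b, (∀ j ∈ I, η j ≤ b) → η p ≤ b := by
  classical
  have : Nonempty L := ⟨(φ ⊥).nonempty.choose⟩
  have hwit : ∀ p x I, ∃ y : JoinIrr S → L, x ∈ φ p.1 → IsMinimalPair p I →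
      (∀ j ∈ I, y j ∈ φ j.1) ∧ ∀ b, (∀ j ∈ I, y j ≤ b) → x ≤ b := by
    intro p x I
    by_cases h : x ∈ φ p.1 ∧ IsMinimalPair p I
    · have hI : I.Nonempty := Finset.card_pos.mp (by have := h.2.two_le_card; omega)
      obtain ⟨y, hy⟩ := exists_family_of_mem_ideal hφ hI (hφ.le_iff_le.mpr h.2.le_join h.1)
      exact ⟨y, fun _ _ => hy⟩
    · exact ⟨fun _ => x, fun h₁ h₂ => absurd ⟨h₁, h₂⟩ h⟩
  -- `wit p x I j`, for `j ∈ I`, are elements of `φ j` whose join is above `x`, if `x ∈ φ p`.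
  choose wit hwit using hwit
  have hsep : ∀ (j : JoinIrr S) (a : S), ∃ x ∈ φ j.1, ¬ j.1 ≤ a → x ∉ φ a := by
    intro j a
    by_cases h : j.1 ≤ a
    · obtain ⟨x, hx⟩ := (φ j.1).nonempty
      exact ⟨x, hx, absurd h⟩
    · obtain ⟨x, hx, hxa⟩ := Set.not_subset.mp fun hle => h (hφ.le_iff_le.mp hle)
      exact ⟨x, hx, fun _ => hxa⟩
  -- `sep j a` is an element of `φ j` outside `φ a`, unless `j ≤ a`.
  choose sep hsep hsep' using hsep
  let good (j : JoinIrr S) (r : ∀ p, Depends p j → L) (u : L) : Prop :=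
    u ∈ φ j.1 ∧ (∀ a, sep j a ≤ u) ∧
      ∀ p I (h : IsMinimalPair p I) (hj : j ∈ I), wit p (r p ⟨I, h, hj⟩) I j ≤ u
  let η : JoinIrr S → L := hwf.fix fun j r => Classical.epsilon (good j r)
  have hη : ∀ j, good j (fun p _ => η p) (η j) := by
    intro j
    induction j using hwf.induction with
    | _ j ih =>
      have hfix : η j = Classical.epsilon (good j fun p _ => η p) := hwf.fix_eq _ j
      rw [hfix]
      apply Classical.epsilon_spec
      let s : Set L := Set.range (sep j) ∪ Set.range fun x : {x : JoinIrr S × Finset (JoinIrr S) //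
        IsMinimalPair x.1 x.2 ∧ j ∈ x.2} => wit x.1.1 (η x.1.1) x.1.2 j
      have hs : s.Finite := (Set.finite_range _).union (Set.finite_range _)
      obtain ⟨u, hu, h⟩ := exists_upperBound_mem_ideal (K := φ j.1) hs <| by
        rintro _ (⟨a, rfl⟩ | ⟨⟨⟨p, I⟩, hI, hj⟩, rfl⟩)
        · exact hsep j a
        · exact (hwit p (η p) I (ih p ⟨I, hI, hj⟩).1 hI).1 j hj
      exact ⟨u, hu, fun a => h _ (.inl ⟨a, rfl⟩),
        fun p I hI hj => h _ (.inr ⟨⟨⟨p, I⟩, hI, hj⟩, rfl⟩)⟩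
  refine ⟨η, fun p => (hη p).1, fun p a h => ?_, fun p I hI b hb => ?_⟩
  · by_contra hpa
    exact hsep' p a hpa ((φ a).lower ((hη p).2.1 a) h)
  · exact (hwit p (η p) I (hη p).1 hI).2 b fun j hj => ((hη j).2.2 p I hI hj).trans (hb j hj)

/-- The value of the lift at `a` is the join of the values at the join-irreducible elements below
`a`. It preserves joins by `exists_joinIrr_lift`, as a join-irreducible element below `x ⊔ y` that
is neither below `x` nor below `y` has a minimal pair consisting of elements that are. -/
theorem isSharplyTransferable_of_wellFounded (hwf : WellFounded (Depends (S := S))) :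
    IsSharplyTransferable.{u, v} S := by
  classical
  intro L _ φ hφ
  obtain ⟨η, hη, hηle, hηI⟩ := exists_joinIrr_lift hwf hφ
  -- `L` need not have a zero, so the value at `⊥` is an arbitrary element of `φ ⊥`.
  obtain ⟨e, he⟩ := (φ ⊥).nonempty
  let ξ (a : S) : L := (Finset.insertNone (below a)).sup' ⟨none, by simp⟩ (Option.elim · e η)
  have hξ : ∀ a b, ξ a ≤ b ↔ e ≤ b ∧ ∀ p : JoinIrr S, p.1 ≤ a → η p ≤ b := by
    intro a b
    refine (Finset.sup'_le_iff _ _).trans ⟨fun h => ⟨h none (by simp), fun p hp =>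
      h (some p) (by simpa using hp)⟩, fun h => ?_⟩
    rintro (_ | p) hp
    · exact h.1
    · exact h.2 p (by simpa using hp)
  have hξη : ∀ {a} {p : JoinIrr S}, p.1 ≤ a → η p ≤ ξ a := fun h => ((hξ _ _).mp le_rfl).2 _ h
  have hiff : ∀ x y, ξ x ∈ φ y ↔ x ≤ y := by
    intro x y
    constructor
    · intro h
      exact le_of_forall_joinIrr fun p hp => hηle p y ((φ y).lower (hξη hp) h)
    · intro h
      refine Finset.sup'_mem (φ y : Set L) (fun a ha b hb => Order.Ideal.sup_mem ha hb) _ _ _ ?_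
      rintro (_ | p) hp
      · exact hφ.le_iff_le.mpr bot_le he
      · exact hφ.le_iff_le.mpr ((mem_below.mp (by simpa using hp)).trans h) (hη p)
  refine ⟨ξ, ⟨fun x y h => ?_, fun x y => ⟨?_, fun b hb => ?_⟩⟩, hiff⟩
  · exact le_antisymm ((hiff _ _).mp (h ▸ (hiff y y).mpr le_rfl))
      ((hiff _ _).mp (h ▸ (hiff x x).mpr le_rfl))
  · rintro _ (rfl | rfl)
    · exact (hξ _ _).mpr ⟨((hξ _ _).mp le_rfl).1, fun p hp => hξη (le_sup_of_le_left hp)⟩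
    · exact (hξ _ _).mpr ⟨((hξ _ _).mp le_rfl).1, fun p hp => hξη (le_sup_of_le_right hp)⟩
  · have hx : ξ x ≤ b := hb (by simp)
    have hy : ξ y ≤ b := hb (by simp)
    refine (hξ _ _).mpr ⟨((hξ _ _).mp hx).1, fun p hp => ?_⟩
    by_cases hpx : p.1 ≤ x
    · exact (hξη hpx).trans hx
    by_cases hpy : p.1 ≤ y
    · exact (hξη hpy).trans hy
    obtain ⟨I, hI, hIxy⟩ := exists_isMinimalPair_of_le_sup hp hpx hpy
    exact hηI p I hI b fun j hj =>
      (hIxy j hj).elim (fun h => (hξη h).trans hx) fun h => (hξη h).trans hy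

end Transfer

/-! ### Sharp transferability implies condition (T) -/

section Levels

variable {S : Type u} [SemilatticeSup S] [OrderBot S] {K : Type w} (e : JoinIrr S ≃ K)

/-- Functions `h` from the join-irreducible elements to `ℕ` such that, for each minimal pair
`⟨p, I⟩`, the minimum of `h` on `I` is at most `h p + 1`. They are encoded as functions on a type
`K` equivalent to the type of join-irreducible elements in order to live in an arbitrary universe.
In other words, with a copy `pₙ` of `p` for each level `n`, they describe the finite sets of such
copies that are closed under the rule that `pₙ` lies below the join of the `jₙ₊₁`, `j ∈ I`. -/
def LevelFun : Type w :=
  {h : K → ℕ // ∀ p I, IsMinimalPair p I → ∃ j ∈ I, h (e j) ≤ h (e p) + 1}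

namespace LevelFun

variable {e}

instance : PartialOrder (LevelFun e) := inferInstanceAs (PartialOrder (Subtype _))

/-- The level of a join-irreducible element. -/
def level (f : LevelFun e) (p : JoinIrr S) : ℕ := f.1 (e p)

theorem le_iff {f g : LevelFun e} : f ≤ g ↔ ∀ p, f.level p ≤ g.level p :=
  ⟨fun h p => h (e p), fun hle k => by
    simpa [level] using hle (e.symm k)⟩

theorem exists_level_le (h : LevelFun e) {p : JoinIrr S} {I : Finset (JoinIrr S)}
    (hI : IsMinimalPair p I) : ∃ j ∈ I, h.level j ≤ h.level p + 1 := h.2 p I hI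

/-- Construction of a level function from a function on the join-irreducible elements. -/
def ofLevel (f : JoinIrr S → ℕ) (hf : ∀ p I, IsMinimalPair p I → ∃ j ∈ I, f j ≤ f p + 1) :
    LevelFun e := ⟨f ∘ e.symm, by simpa using hf⟩

@[simp]
theorem level_ofLevel (f : JoinIrr S → ℕ) (hf) (p : JoinIrr S) :
    (ofLevel f hf : LevelFun e).level p = f p := by simp [level, ofLevel]

open Classical in
/-- The level function that takes the constant value `n` below `a` and vanishes elsewhere. -/
noncomputable def box (a : S) (n : ℕ) : LevelFun e :=
  ofLevel (fun p => if p.1 ≤ a then n else 0) fun p I hI => by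
    by_cases hp : p.1 ≤ a
    · have hne : I.Nonempty := Finset.card_pos.mp (by have := hI.two_le_card; omega)
      obtain ⟨j, hj⟩ := hne
      exact ⟨j, hj, by simp only [hp, if_true]; split_ifs <;> omega⟩
    · obtain ⟨j, hj, hja⟩ : ∃ j ∈ I, ¬ j.1 ≤ a := by
        by_contra! h
        exact hp (hI.le_join.trans (bigJoin_le_iff.mpr h))
      exact ⟨j, hj, by simp [hja]⟩

open Classical in
theorem level_box (a : S) (n : ℕ) (p : JoinIrr S) :
    (box a n : LevelFun e).level p = if p.1 ≤ a then n else 0 := level_ofLevel _ _ _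

theorem box_mono {a b : S} {m n : ℕ} (hab : a ≤ b) (hmn : m ≤ n) :
    (box a m : LevelFun e) ≤ box b n := le_iff.mpr fun p => by
  rw [level_box, level_box]
  by_cases hp : p.1 ≤ a
  · simpa [hp, hp.trans hab] using hmn
  · simp [hp]

variable (e) in
/-- The ideal of level functions that vanish outside the elements below `a`. -/
noncomputable def ideal (a : S) : Order.Ideal (LevelFun e) where
  carrier := {f | ∃ n, f ≤ box a n}
  lower' := by
    rintro f g hgf ⟨n, hn⟩
    exact ⟨n, hgf.trans hn⟩
  nonempty' := ⟨box a 0, 0, le_rfl⟩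
  directed' := by
    rintro f ⟨m, hm⟩ g ⟨n, hn⟩
    exact ⟨box a (max m n), ⟨_, le_rfl⟩, hm.trans (box_mono le_rfl (le_max_left _ _)),
      hn.trans (box_mono le_rfl (le_max_right _ _))⟩

theorem box_mem_ideal (a : S) (n : ℕ) : box a n ∈ ideal e a := ⟨n, le_rfl⟩

theorem level_eq_zero {f : LevelFun e} {a : S} (hf : f ∈ ideal e a) {p : JoinIrr S}
    (hp : ¬ p.1 ≤ a) : f.level p = 0 := by
  obtain ⟨n, hn⟩ := hf
  simpa [level_box, hp] using le_iff.mp hn p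

variable [Finite S]

theorem exists_level_bound (f : LevelFun e) : ∃ n, ∀ p, f.level p ≤ n := by
  obtain ⟨n, hn⟩ := (Set.finite_range f.level).bddAbove
  exact ⟨n, fun p => hn ⟨p, rfl⟩⟩

/-- The levels occurring at `p` in the upper bounds of `f` and `g`. -/
def upperLevels (f g : LevelFun e) (p : JoinIrr S) : Set ℕ :=
  {n | ∃ h : LevelFun e, f ≤ h ∧ g ≤ h ∧ h.level p = n}

theorem upperLevels_nonempty (f g : LevelFun e) (p : JoinIrr S) : (upperLevels f g p).Nonempty := by
  have := Fintype.ofFinite (JoinIrr S)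
  obtain ⟨m, hm⟩ := f.exists_level_bound
  obtain ⟨n, hn⟩ := g.exists_level_bound
  have htop : ∀ q : JoinIrr S, q.1 ≤ bigJoin Finset.univ := fun q => le_bigJoin (Finset.mem_univ q)
  refine ⟨_, box (bigJoin Finset.univ) (max m n), le_iff.mpr fun q => ?_,
    le_iff.mpr fun q => ?_, rfl⟩
  · simpa [level_box, htop] using .inl (hm q)
  · simpa [level_box, htop] using .inr (hn q)

/-- Pointwise infima of level functions are level functions; the join of two level functions is the
pointwise infimum of their upper bounds. -/
noncomputable instance : SemilatticeSup (LevelFun e) where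
  sup f g := ofLevel (fun p => sInf (upperLevels f g p)) fun p I hI => by
    obtain ⟨h, hf, hg, hp⟩ := Nat.sInf_mem (upperLevels_nonempty f g p)
    obtain ⟨j, hj, hjp⟩ := h.exists_level_le hI
    have hle : sInf (upperLevels f g j) ≤ h.level j := Nat.sInf_le ⟨h, hf, hg, rfl⟩
    rw [hp] at hjp
    exact ⟨j, hj, hle.trans hjp⟩
  le_sup_left f g := le_iff.mpr fun p => by
    obtain ⟨h, hf, hg, hp⟩ := Nat.sInf_mem (upperLevels_nonempty f g p)
    rw [level_ofLevel, ← hp]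
    exact le_iff.mp hf p
  le_sup_right f g := le_iff.mpr fun p => by
    obtain ⟨h, hf, hg, hp⟩ := Nat.sInf_mem (upperLevels_nonempty f g p)
    rw [level_ofLevel, ← hp]
    exact le_iff.mp hg p
  sup_le f g h hf hg := le_iff.mpr fun p => by
    rw [level_ofLevel]
    exact Nat.sInf_le ⟨h, hf, hg, rfl⟩

theorem mem_ideal {f : LevelFun e} {a : S} (hf : ∀ p : JoinIrr S, ¬ p.1 ≤ a → f.level p = 0) :
    f ∈ ideal e a := by
  obtain ⟨n, hn⟩ := f.exists_level_bound
  refine ⟨n, le_iff.mpr fun p => ?_⟩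
  by_cases hp : p.1 ≤ a
  · simpa [level_box, hp] using hn p
  · simp [hf p hp]

/-- Embedding of `S` into the ideals of `LevelFun e`, to which sharp transferability is applied. -/
theorem isJoinEmbedding_ideal : IsJoinEmbedding (ideal e) := by
  classical
  have hle : ∀ a b, ideal e a = ideal e b → a ≤ b := fun a b h => by
    refine le_of_forall_joinIrr fun p hp => ?_
    by_contra hpb
    have := level_eq_zero (h ▸ box_mem_ideal (e := e) a 1) hpb
    simp [level_box, hp] at this
  refine ⟨fun a b h => le_antisymm (hle a b h) (hle b a h.symm), fun a b => ⟨?_, fun K hK => ?_⟩⟩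
  · rintro _ (rfl | rfl) f ⟨n, hn⟩
    · exact ⟨n, hn.trans (box_mono le_sup_left le_rfl)⟩
    · exact ⟨n, hn.trans (box_mono le_sup_right le_rfl)⟩
  · rintro f ⟨n, hn⟩
    -- A minimal pair lowers the level by one, so `n + 1` on `a` and `b` forces `n` on `a ⊔ b`.
    have ha : box a (n + 1) ∈ K := hK (show ideal e a ∈ _ by simp) (box_mem_ideal a _)
    have hb : box b (n + 1) ∈ K := hK (show ideal e b ∈ _ by simp) (box_mem_ideal b _)
    refine K.lower (hn.trans (le_iff.mpr fun p => ?_)) (Order.Ideal.sup_mem ha hb)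
    rw [level_box]
    split_ifs with hp
    · set h : LevelFun e := box a (n + 1) ⊔ box b (n + 1)
      have hX : ∀ q : JoinIrr S, q.1 ≤ a ∨ q.1 ≤ b → n + 1 ≤ h.level q := by
        rintro q (hq | hq)
        · have := le_iff.mp (show box a (n + 1) ≤ h from le_sup_left) q
          simpa [level_box, hq] using this
        · have := le_iff.mp (show box b (n + 1) ≤ h from le_sup_right) q
          simpa [level_box, hq] using this
      by_cases hpX : p.1 ≤ a ∨ p.1 ≤ b
      · exact (Nat.le_succ n).trans (hX p hpX)
      · obtain ⟨I, hI, hIX⟩ := exists_isMinimalPair_of_le_sup hp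
          (fun h => hpX (.inl h)) fun h => hpX (.inr h)
        obtain ⟨j, hj, hjp⟩ := h.exists_level_le hI
        exact Nat.le_of_succ_le_succ ((hX j (hIX j hj)).trans hjp)
    · exact Nat.zero_le _

/-- For a sharp lift `ξ` of the embedding `ideal`, the level of `ξ p` at `p` increases strictly
along minimal pairs. -/
theorem level_lt_level {ξ : S → LevelFun e} (hξ : IsJoinEmbedding ξ)
    (hiff : ∀ x y, ξ x ∈ ideal e y ↔ x ≤ y) {p j : JoinIrr S} {I : Finset (JoinIrr S)}
    (hI : IsMinimalPair p I) (hj : j ∈ I) : (ξ p.1).level p < (ξ j.1).level j := by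
  classical
  have hzero : ∀ p q : JoinIrr S, ¬ q ≤ p → (ξ p.1).level q = 0 := fun p q h =>
    level_eq_zero ((hiff p.1 p.1).mpr le_rfl) h
  have hpos : (ξ p.1).level p ≠ 0 := by
    intro h0
    -- The join of the elements strictly below `p`.
    let a := bigJoin ((below p.1).erase p)
    have hpa : ¬ p.1 ≤ a := fun h => by
      have ha : a ≤ p.1 := bigJoin_le_iff.mpr fun q hq => mem_below.mp (Finset.mem_of_mem_erase hq)
      exact Finset.notMem_erase p _ (mem_of_val_eq_bigJoin (le_antisymm h ha))
    refine hpa ((hiff _ _).mp (mem_ideal fun q hq => ?_))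
    by_cases hqp : q ≤ p
    · by_cases hne : q = p
      · rw [hne, h0]
      · exact absurd (le_bigJoin (Finset.mem_erase.mpr ⟨hne, mem_below.mpr hqp⟩)) hq
    · exact hzero p q hqp
  by_contra! hle
  set n := (ξ p.1).level p
  obtain ⟨m, hm⟩ : ∃ m, ∀ (i q : JoinIrr S), (ξ i.1).level q ≤ m := by
    obtain ⟨m, hm⟩ :=
      (Set.finite_range fun x : JoinIrr S × JoinIrr S => (ξ x.1.1).level x.2).bddAbove
    exact ⟨m, fun i q => hm ⟨(i, q), rfl⟩⟩
  -- A level function above all `ξ i`, `i ∈ I`, that stays below level `n` at `p`.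
  let g : LevelFun e := ofLevel
    (fun q => if q.1 ≤ truncJoin I j then m else if q = j then n else n - 1) fun q X hX => by
      by_cases hq : q.1 ≤ truncJoin I j
      · have hne : X.Nonempty := Finset.card_pos.mp (by have := hX.two_le_card; omega)
        obtain ⟨k, hk⟩ := hne
        have hnm : n ≤ m := hm p p
        exact ⟨k, hk, by simp only [hq, if_true]; split_ifs <;> omega⟩
      · obtain ⟨k, hk, hkj⟩ : ∃ k ∈ X, ¬ k.1 ≤ truncJoin I j := by
          by_contra! h
          exact hq (hX.le_join.trans (bigJoin_le_iff.mpr h))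
        exact ⟨k, hk, by simp only [hq, hkj, if_false]; split_ifs <;> omega⟩
  have hg : ∀ i ∈ I, ξ i.1 ≤ g := fun i hi => le_iff.mpr fun q => by
    rw [level_ofLevel]
    by_cases hqi : q ≤ i
    · by_cases hqj : q = j
      · subst hqj
        have := hI.eq_of_le hj hi hqi
        subst this
        rw [if_pos rfl]
        split_ifs
        · exact hm _ _
        · exact hle
      · rw [if_pos (le_truncJoin hi hqi hqj)]
        exact hm _ _
    · rw [hzero i q hqi]
      exact Nat.zero_le _
  have hpg : ξ p.1 ≤ g := (hξ.le_iff_le.mpr hI.le_join).trans (hξ.apply_bigJoin_le ⟨j, hj⟩ hg)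
  have := le_iff.mp hpg p
  rw [level_ofLevel, if_neg (hI.not_le_truncJoin hj),
    if_neg fun e : p = j => hI.notMem (e ▸ hj)] at this
  change n ≤ n - 1 at this
  omega

end LevelFun

/-- The join-irreducible elements are shrunk to the universe of the semilattices that the hypothesis
speaks about. -/
theorem wellFounded_of_isSharplyTransferable [Finite S] (h : IsSharplyTransferable.{u, w} S) :
    WellFounded (Depends (S := S)) := by
  obtain ⟨ξ, hξ, hiff⟩ := h (LevelFun (equivShrink.{w} (JoinIrr S))) _
    LevelFun.isJoinEmbedding_ideal
  refine Subrelation.wf ?_ (measure fun p : JoinIrr S => (ξ p.1).level p).wf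
  rintro p j ⟨I, hI, hj⟩
  exact LevelFun.level_lt_level hξ hiff hI hj

end Levels

/-! ### Pure tensors and bi-ideals -/

section Tensors

variable {A : Type u} {B : Type v} [SemilatticeSup A] [OrderBot A] [SemilatticeSup B] [OrderBot B]

/-- Makes the join of the tensor product syntactically the one of its structure of a
join-semilattice. -/
noncomputable local instance : Max (Tensor A B) := SemilatticeSup.toMax

open Classical in
/-- The pure tensor of two arbitrary elements; it is `⊥` if one of them is zero. -/
noncomputable def tens (a : A) (b : B) : Tensor A B :=
  if h : a ≠ ⊥ ∧ b ≠ ⊥ then Tensor.mk {(⟨a, h.1⟩, ⟨b, h.2⟩)} else ⊥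

@[simp]
theorem tens_bot_left (b : B) : tens (⊥ : A) b = ⊥ := by simp [tens]

@[simp]
theorem tens_bot_right (a : A) : tens a (⊥ : B) = ⊥ := by simp [tens]

theorem tens_nonBot (a : NonBot A) (b : NonBot B) : tens a.1 b.1 = Tensor.mk {(a, b)} := by
  rw [tens, dif_pos ⟨a.2, b.2⟩]

theorem tens_sup_right (a : A) (b₀ b₁ : B) : tens a (b₀ ⊔ b₁) = tens a b₀ ⊔ tens a b₁ := by
  by_cases ha : a = ⊥
  · simp [ha]
  by_cases h₀ : b₀ = ⊥
  · simp [h₀]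
  by_cases h₁ : b₁ = ⊥
  · simp [h₁]
  have := tens_nonBot ⟨a, ha⟩ (NonBot.join ⟨b₀, h₀⟩ ⟨b₁, h₁⟩)
  refine this.trans ?_
  rw [show tens a b₀ = _ from tens_nonBot ⟨a, ha⟩ ⟨b₀, h₀⟩,
    show tens a b₁ = _ from tens_nonBot ⟨a, ha⟩ ⟨b₁, h₁⟩]
  exact Quotient.sound (TensorRel.join_right _ _ _).symm

theorem tens_sup_left (a₀ a₁ : A) (b : B) : tens (a₀ ⊔ a₁) b = tens a₀ b ⊔ tens a₁ b := by
  by_cases hb : b = ⊥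
  · simp [hb]
  by_cases h₀ : a₀ = ⊥
  · simp [h₀]
  by_cases h₁ : a₁ = ⊥
  · simp [h₁]
  have := tens_nonBot (NonBot.join ⟨a₀, h₀⟩ ⟨a₁, h₁⟩) ⟨b, hb⟩
  refine this.trans ?_
  rw [show tens a₀ b = _ from tens_nonBot ⟨a₀, h₀⟩ ⟨b, hb⟩,
    show tens a₁ b = _ from tens_nonBot ⟨a₁, h₁⟩ ⟨b, hb⟩]
  exact Quotient.sound (TensorRel.join_left _ _ _).symm

theorem tens_mono {a a' : A} {b b' : B} (ha : a ≤ a') (hb : b ≤ b') : tens a b ≤ tens a' b' := by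
  rw [← sup_eq_right.mpr ha, ← sup_eq_right.mpr hb, tens_sup_left, tens_sup_right]
  exact le_sup_of_le_left le_sup_left

theorem Tensor.mk_le_iff {t : Finset (NonBot A × NonBot B)} {z : Tensor A B} :
    Tensor.mk t ≤ z ↔ ∀ x ∈ t, tens x.1.1 x.2.1 ≤ z := by
  classical
  induction t using Finset.induction_on with
  | empty => exact iff_of_true (bot_le (a := z)) (by simp)
  | insert x t _ ih =>
    have : Tensor.mk (insert x t) = tens x.1.1 x.2.1 ⊔ Tensor.mk t := by
      rw [tens_nonBot, Finset.insert_eq]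
      refine congrArg Tensor.mk ?_
      congr!
    rw [this, sup_le_iff, ih, Finset.forall_mem_insert]

/-- The order of the tensor product is determined by the pure tensors below an element. -/
theorem Tensor.le_of_forall_tens {y z : Tensor A B} (h : ∀ a b, tens a b ≤ y → tens a b ≤ z) :
    y ≤ z := by
  obtain ⟨t⟩ := y
  exact Tensor.mk_le_iff.mpr fun x hx => h _ _ (Tensor.mk_le_iff.mp le_rfl x hx)

/-- A bi-ideal of `A × B`: a lower set that contains `(a, b)` whenever `a` or `b` is zero and is
closed under joins in each variable separately. -/
structure IsBiIdeal (I : A → B → Prop) : Prop where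
  bot_left : ∀ b, I ⊥ b
  bot_right : ∀ a, I a ⊥
  mono : ∀ {a a' b b'}, a ≤ a' → b ≤ b' → I a' b' → I a b
  sup_left : ∀ {a₀ a₁ b}, I a₀ b → I a₁ b → I (a₀ ⊔ a₁) b
  sup_right : ∀ {a b₀ b₁}, I a b₀ → I a b₁ → I a (b₀ ⊔ b₁)

theorem IsBiIdeal.forall_iff_of_rel {I : A → B → Prop} (hI : IsBiIdeal I)
    {s t : Finset (NonBot A × NonBot B)} (h : TensorRel A B s t) :
    (∀ x ∈ s, I x.1.1 x.2.1) ↔ ∀ x ∈ t, I x.1.1 x.2.1 := by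
  induction h with
  | refl s => rfl
  | symm _ ih => exact ih.symm
  | trans _ _ ih₁ ih₂ => exact ih₁.trans ih₂
  | union _ _ ih₁ ih₂ =>
    simp only [Finset.mem_union, or_imp, forall_and]
    exact and_congr ih₁ ih₂
  | join_right a b₀ b₁ =>
    simp only [Finset.mem_union, Finset.mem_singleton, or_imp, forall_and, forall_eq]
    exact ⟨fun h => hI.sup_right h.1 h.2, fun h => ⟨hI.mono le_rfl le_sup_left h,
      hI.mono le_rfl le_sup_right h⟩⟩
  | join_left a₀ a₁ b =>
    simp only [Finset.mem_union, Finset.mem_singleton, or_imp, forall_and, forall_eq]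
    exact ⟨fun h => hI.sup_left h.1 h.2, fun h => ⟨hI.mono le_sup_left le_rfl h,
      hI.mono le_sup_right le_rfl h⟩⟩

/-- A pure tensor below the join of the generators in `t` belongs to every bi-ideal that contains
`t`. -/
theorem IsBiIdeal.of_tens_le {I : A → B → Prop} (hI : IsBiIdeal I)
    {t : Finset (NonBot A × NonBot B)} (ht : ∀ x ∈ t, I x.1.1 x.2.1) {a : A} {b : B}
    (h : tens a b ≤ Tensor.mk t) : I a b := by
  classical
  by_cases ha : a = ⊥
  · exact ha ▸ hI.bot_left b
  by_cases hb : b = ⊥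
  · exact hb ▸ hI.bot_right a
  rw [show tens a b = _ from tens_nonBot ⟨a, ha⟩ ⟨b, hb⟩] at h
  have hrel := Quotient.exact (sup_eq_right.mpr h)
  have := (hI.forall_iff_of_rel hrel).mpr ht
  exact this (⟨a, ha⟩, ⟨b, hb⟩) (Finset.mem_union_left _ (Finset.mem_singleton_self _))

/-- The variant of `IsBiIdeal.of_tens_le` for generators that may be zero. -/
theorem IsBiIdeal.of_tens_le_sup {I : A → B → Prop} (hI : IsBiIdeal I) {ι : Type w} {s : Finset ι}
    {f : ι → A} {g : ι → B} (h : ∀ i ∈ s, I (f i) (g i)) {a : A} {b : B}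
    (hab : tens a b ≤ s.sup fun i => tens (f i) (g i)) : I a b := by
  classical
  have key : ∃ t, s.sup (fun i => tens (f i) (g i)) = Tensor.mk t ∧ ∀ x ∈ t, I x.1.1 x.2.1 := by
    refine Finset.sup_induction
      (p := fun z => ∃ t, z = Tensor.mk t ∧ ∀ x ∈ t, I x.1.1 x.2.1) ⟨∅, rfl, by simp⟩ ?_ ?_
    · rintro _ ⟨t, rfl, ht⟩ _ ⟨t', rfl, ht'⟩
      refine ⟨t ∪ t', ?_, fun x hx => (Finset.mem_union.mp hx).elim (ht x) (ht' x)⟩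
      refine Eq.trans (b := Tensor.mk _) rfl (congrArg Tensor.mk ?_)
      congr!
    · intro i hi
      by_cases hne : f i ≠ ⊥ ∧ g i ≠ ⊥
      · refine ⟨{(⟨f i, hne.1⟩, ⟨g i, hne.2⟩)}, tens_nonBot ⟨f i, hne.1⟩ ⟨g i, hne.2⟩, ?_⟩
        simpa using h i hi
      · exact ⟨∅, dif_neg hne, by simp⟩
  obtain ⟨t, ht, htI⟩ := key
  exact hI.of_tens_le htI (ht ▸ hab)

theorem tens_bigJoin_le {C : Finset (JoinIrr A)} {b : B} {z : Tensor A B}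
    (h : ∀ q ∈ C, tens q.1 b ≤ z) : tens (bigJoin C) b ≤ z :=
  Finset.sup_induction (p := fun a => tens a b ≤ z) (by simp)
    (fun a ha a' ha' => (tens_sup_left a a' b).trans_le (sup_le ha ha')) h

theorem tens_le_of_forall_joinIrr [Finite A] {a : A} {b : B} {z : Tensor A B}
    (h : ∀ q : JoinIrr A, q.1 ≤ a → tens q.1 b ≤ z) : tens a b ≤ z := by
  rw [← bigJoin_below a]
  exact tens_bigJoin_le fun q hq => h q (mem_below.mp hq)

end Tensors

/-! ### The adjustment of a function on the join-irreducible elements -/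

section Adjust

variable {A : Type u} [SemilatticeSup A] [OrderBot A] [Finite A] {L : Type v} [Lattice L]

/-- One step in the computation of the bi-ideal of `A × L` generated by the pairs `(p, g p)`: if
`p` lies below the join of `C` then `(p, ⋀ g[C])` belongs to that bi-ideal, and the new value at `p`
is the join over all such nonempty sets `C`. -/
noncomputable def adjust (g : JoinIrr A → L) (p : JoinIrr A) : L :=
  (Set.toFinite {C : {C : Finset (JoinIrr A) // C.Nonempty} | p.1 ≤ bigJoin C.1}).toFinset.sup'
    ⟨⟨{p}, Finset.singleton_nonempty p⟩, by simp [bigJoin]⟩ fun C => C.1.inf' C.2 g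

variable {g : JoinIrr A → L} {p q : JoinIrr A}

theorem le_adjust {C : Finset (JoinIrr A)} (hC : C.Nonempty) (hp : p.1 ≤ bigJoin C) {b : L}
    (hb : ∀ q ∈ C, b ≤ g q) : b ≤ adjust g p :=
  (Finset.le_inf' hC g hb).trans <|
    Finset.le_sup' (fun D : {D : Finset (JoinIrr A) // D.Nonempty} => D.1.inf' D.2 g)
      (b := ⟨C, hC⟩)
      ((Set.Finite.mem_toFinset _).mpr hp)

theorem adjust_induction {P : L → Prop} (hsup : ∀ a b, P a → P b → P (a ⊔ b))
    (h : ∀ C (hC : C.Nonempty), p.1 ≤ bigJoin C → P (C.inf' hC g)) : P (adjust g p) :=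
  Finset.sup'_induction _ _ (fun a ha b hb => hsup a b ha hb) fun C hC =>
    h C.1 C.2 (by simpa using hC)

theorem adjust_le {c : L} (h : ∀ C (hC : C.Nonempty), p.1 ≤ bigJoin C → C.inf' hC g ≤ c) :
    adjust g p ≤ c :=
  adjust_induction (P := (· ≤ c)) (fun _ _ => sup_le) h

theorem le_adjust_self (g : JoinIrr A → L) (p : JoinIrr A) : g p ≤ adjust g p :=
  le_adjust (Finset.singleton_nonempty p) (le_bigJoin (Finset.mem_singleton_self p)) (by simp)

theorem iterate_adjust_le {c : JoinIrr A → L} (hg : ∀ q, g q ≤ c q) (hc : ∀ q, adjust c q ≤ c q)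
    (n : ℕ) (p : JoinIrr A) : adjust^[n] g p ≤ c p := by
  induction n generalizing p with
  | zero => exact hg p
  | succ n ih =>
    rw [Function.iterate_succ_apply']
    refine le_trans (adjust_le fun C hC hp => ?_) (hc p)
    exact le_adjust hC hp fun q hq => (Finset.inf'_le _ hq).trans (ih q)

theorem adjust_const_le (c : L) (p : JoinIrr A) : adjust (fun _ => c) p ≤ c :=
  adjust_le fun C hC _ => by simp

theorem adjust_antitone (g : JoinIrr A → L) (h : p ≤ q) : adjust g q ≤ adjust g p :=
  adjust_le fun _ hC hq => le_adjust hC (le_trans h hq) fun _ hr => Finset.inf'_le g hr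

theorem map_adjust {M : Type w} [Lattice M] (f : LatticeHom L M) (g : JoinIrr A → L) :
    f ∘ adjust g = adjust (f ∘ g) := by
  funext p
  refine (map_finset_sup' f _ _).trans (Finset.sup'_congr _ rfl fun C _ => ?_)
  exact map_finset_inf' f _ _

theorem map_iterate_adjust {M : Type w} [Lattice M] (f : LatticeHom L M) (g : JoinIrr A → L)
    (n : ℕ) : f ∘ adjust^[n] g = adjust^[n] (f ∘ g) := by
  induction n with
  | zero => rfl
  | succ n ih => rw [Function.iterate_succ_apply', Function.iterate_succ_apply', map_adjust, ih]

theorem iterate_adjust_mono (g : JoinIrr A → L) (p : JoinIrr A) {m n : ℕ} (h : m ≤ n) :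
    adjust^[m] g p ≤ adjust^[n] g p := by
  induction n, h using Nat.le_induction with
  | base => exact le_rfl
  | succ n _ ih =>
    rw [Function.iterate_succ_apply']
    exact ih.trans (le_adjust_self _ p)

/-- For antitone functions, only minimal pairs contribute to an adjustment. -/
theorem adjust_le_of_isMinimalPair (hg : Antitone g) {c : L} (hp : g p ≤ c)
    (h : ∀ I (hI : I.Nonempty), IsMinimalPair p I → I.inf' hI g ≤ c) : adjust g p ≤ c := by
  refine adjust_le fun C hC hpC => ?_
  by_cases hq : ∃ q ∈ C, p ≤ q
  · obtain ⟨q, hqC, hpq⟩ := hq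
    exact (Finset.inf'_le g hqC).trans ((hg hpq).trans hp)
  · push Not at hq
    obtain ⟨I, hI, hIC⟩ := exists_isMinimalPair hpC hq
    have hne : I.Nonempty := Finset.card_pos.mp (by have := hI.two_le_card; omega)
    refine le_trans (Finset.le_inf' hne g fun i hi => ?_) (h I hne hI)
    obtain ⟨q, hqC, hiq⟩ := hIC i hi
    exact (Finset.inf'_le g hqC).trans (hg hiq)

theorem wellFounded_swap_depends (hwf : WellFounded (Depends (S := A))) :
    WellFounded fun j p : JoinIrr A => Depends p j := by
  have : Std.Irrefl fun j p : JoinIrr A => Relation.TransGen Depends p j :=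
    ⟨fun a h => hwf.transGen.irrefl.irrefl a h⟩
  have : IsTrans (JoinIrr A) fun j p => Relation.TransGen Depends p j :=
    ⟨fun a b c h k => k.trans h⟩
  exact Subrelation.wf (fun h => .single h) (Finite.wellFounded_of_trans_of_irrefl
    fun j p : JoinIrr A => Relation.TransGen Depends p j)

/-- Under condition (T) the iterated adjustments of any function become stationary. -/
theorem exists_iterate_adjust_stationary (hwf : WellFounded (Depends (S := A)))
    (g : JoinIrr A → L) : ∃ n, ∀ p, adjust (adjust^[n] g) p ≤ adjust^[n] g p := by
  -- Once the values at all `j` on which `p` depends are stationary, so is the value at `p` one step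
  -- later, because the first adjustment makes the function antitone.
  have key : ∀ p, ∃ n, ∀ m ≥ n, adjust^[m] g p ≤ adjust^[n] g p := by
    intro p
    induction p using (wellFounded_swap_depends hwf).induction with
    | _ p ih =>
      have ih' : ∀ j, ∃ n, Depends p j → ∀ m ≥ n, adjust^[m] g j ≤ adjust^[n] g j := fun j => by
        by_cases h : Depends p j
        · exact (ih j h).imp fun n hn _ => hn
        · exact ⟨0, fun h' => absurd h' h⟩
      choose N hN using ih'
      obtain ⟨n, hn⟩ := (Set.finite_range N).bddAbove
      refine ⟨n + 1, fun m hm => ?_⟩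
      induction m, hm using Nat.le_induction with
      | base => exact le_rfl
      | succ m hm ihm =>
        obtain ⟨k, rfl⟩ : ∃ k, m = k + 1 := ⟨m - 1, by omega⟩
        rw [Function.iterate_succ_apply' _ (k + 1)]
        refine adjust_le_of_isMinimalPair ?_ ihm fun I hI hpI => ?_
        · rw [Function.iterate_succ_apply']
          exact fun _ _ => adjust_antitone _
        · rw [Function.iterate_succ_apply' _ n]
          refine le_adjust hI hpI.le_join fun j hj => (Finset.inf'_le _ hj).trans ?_
          have hNn : N j ≤ n := hn ⟨j, rfl⟩
          exact (hN j ⟨I, hpI, hj⟩ _ (by omega)).trans (iterate_adjust_mono g j hNn)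
  choose N hN using key
  obtain ⟨n, hn⟩ := (Set.finite_range N).bddAbove
  refine ⟨n, fun p => ?_⟩
  have hNn : N p ≤ n := hn ⟨p, rfl⟩
  rw [← Function.iterate_succ_apply' adjust n]
  exact (hN p _ (by omega)).trans (iterate_adjust_mono g p hNn)

variable [OrderBot L]

theorem tens_iterate_adjust_le {z : Tensor A L} (h : ∀ p, tens p.1 (g p) ≤ z) (n : ℕ)
    (p : JoinIrr A) : tens p.1 (adjust^[n] g p) ≤ z := by
  induction n generalizing p with
  | zero => exact h p
  | succ n ih =>
    rw [Function.iterate_succ_apply']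
    refine adjust_induction (P := fun b => tens p.1 b ≤ z)
      (fun b b' hb hb' => (tens_sup_right _ _ _).trans_le (sup_le hb hb')) fun C hC hp => ?_
    exact (tens_mono hp le_rfl).trans <| tens_bigJoin_le fun q hq =>
      (tens_mono le_rfl (Finset.inf'_le _ hq)).trans (ih q)

/-- The iterated adjustments describe the bi-ideal generated by the pairs `(p, g p)`; that it is
contained in every element above these tensors is `tens_iterate_adjust_le`. -/
theorem isBiIdeal_iterate_adjust (g : JoinIrr A → L) :
    IsBiIdeal fun (a : A) (b : L) => ∃ n, ∀ p : JoinIrr A, p.1 ≤ a → b ≤ adjust^[n] g p where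
  bot_left b := ⟨0, fun p hp => absurd (le_bot_iff.mp hp) (joinIrr_ne_bot p)⟩
  bot_right a := ⟨0, fun p _ => bot_le⟩
  mono ha hb := fun ⟨n, hn⟩ => ⟨n, fun p hp => hb.trans (hn p (hp.trans ha))⟩
  sup_left := by
    classical
    rintro a₀ a₁ b ⟨m, hm⟩ ⟨n, hn⟩
    refine ⟨max m n + 1, fun p hp => ?_⟩
    rw [Function.iterate_succ_apply']
    have hX : bigJoin (below a₀ ∪ below a₁) = a₀ ⊔ a₁ := by
      rw [show bigJoin (below a₀ ∪ below a₁) = bigJoin (below a₀) ⊔ bigJoin (below a₁) from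
        Finset.sup_union, bigJoin_below, bigJoin_below]
    refine le_adjust (C := below a₀ ∪ below a₁) ?_ (hp.trans_eq hX.symm) fun q hq => ?_
    · rw [Finset.nonempty_iff_ne_empty]
      intro h
      rw [h] at hX
      exact joinIrr_ne_bot p (le_bot_iff.mp (hp.trans_eq hX.symm))
    · rcases Finset.mem_union.mp hq with hq | hq
      · exact (hm q (mem_below.mp hq)).trans (iterate_adjust_mono g q (le_max_left _ _))
      · exact (hn q (mem_below.mp hq)).trans (iterate_adjust_mono g q (le_max_right _ _))
  sup_right := by
    rintro a b₀ b₁ ⟨m, hm⟩ ⟨n, hn⟩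
    exact ⟨max m n, fun p hp => sup_le
      ((hm p hp).trans (iterate_adjust_mono g p (le_max_left _ _)))
      ((hn p hp).trans (iterate_adjust_mono g p (le_max_right _ _)))⟩

/-- Under condition (T) every element `z` of `A ⊗ L` is capped: the pure tensors `p ⊗ g p` dominate
all pure tensors below `z`, for a suitable function `g` on the join-irreducible elements of `A`. -/
theorem exists_tens_le_imp (hwf : WellFounded (Depends (S := A))) (z : Tensor A L) :
    ∃ g : JoinIrr A → L, (∀ p, tens p.1 (g p) ≤ z) ∧
      ∀ a b, tens a b ≤ z → ∀ p : JoinIrr A, p.1 ≤ a → b ≤ g p := by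
  classical
  obtain ⟨t⟩ := z
  change ∃ g : JoinIrr A → L, (∀ p, tens p.1 (g p) ≤ Tensor.mk t) ∧ ∀ a b,
    tens a b ≤ Tensor.mk t → _
  let x (p : JoinIrr A) : L := t.sup fun y => if p.1 ≤ y.1.1 then y.2.1 else ⊥
  have hx : ∀ p, tens p.1 (x p) ≤ Tensor.mk t := fun p =>
    Finset.sup_induction (p := fun b => tens p.1 b ≤ Tensor.mk t) (by simp)
      (fun b hb b' hb' => (tens_sup_right _ _ _).trans_le (sup_le hb hb')) fun y hy => by
        split_ifs with hp
        · exact (tens_mono hp le_rfl).trans (Tensor.mk_le_iff.mp le_rfl y hy)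
        · simp
  obtain ⟨n, hn⟩ := exists_iterate_adjust_stationary hwf x
  have hstat : ∀ m p, adjust^[m] x p ≤ adjust^[n] x p :=
    iterate_adjust_le (fun p => iterate_adjust_mono x p (Nat.zero_le n)) hn
  refine ⟨adjust^[n] x, tens_iterate_adjust_le hx n, fun a b h => ?_⟩
  obtain ⟨m, hm⟩ := (isBiIdeal_iterate_adjust x).of_tens_le (t := t)
    (fun y hy => ⟨0, fun p hp => by
      refine le_trans ?_ (Finset.le_sup hy)
      rw [if_pos hp]⟩) h
  exact fun p hp => (hm p hp).trans (hstat m p)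

/-- Meets in `A ⊗ L` are computed from the pointwise meets of the functions that cap the two
elements. -/
theorem isLatticeOrdered_of_wellFounded (hwf : WellFounded (Depends (S := A))) :
    IsLatticeOrdered (Tensor A L) := by
  have := Fintype.ofFinite (JoinIrr A)
  intro y z
  obtain ⟨f, hf, hf'⟩ := exists_tens_le_imp hwf y
  obtain ⟨g, hg, hg'⟩ := exists_tens_le_imp hwf z
  refine ⟨Finset.univ.sup fun p : JoinIrr A => tens p.1 (f p ⊓ g p), ?_, fun w hw => ?_⟩
  · rintro _ (rfl | rfl)
    · exact Finset.sup_le fun p _ => (tens_mono le_rfl inf_le_left).trans (hf p)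
    · exact Finset.sup_le fun p _ => (tens_mono le_rfl inf_le_right).trans (hg p)
  · refine Tensor.le_of_forall_tens fun a b hab => tens_le_of_forall_joinIrr fun p hp => ?_
    refine le_trans (tens_mono le_rfl (le_inf ?_ ?_))
      (Finset.le_sup (f := fun p : JoinIrr A => tens p.1 (f p ⊓ g p)) (Finset.mem_univ p))
    · exact hf' a b (hab.trans (hw (by simp))) p hp
    · exact hg' a b (hab.trans (hw (by simp))) p hp

end Adjust

/-! ### A lattice in which the iterated adjustments are not stationary -/

section Chain

variable {A : Type u} [SemilatticeSup A]

/-- The lattice of sets consisting of elements `inl j`, for `j` join-irreducible, and `inr k`, for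
`k : ℕ`, that are closed under the rule that `inl p₍ₖ₊₁₎` and `inr k` produce `inr (k + 1)`. It is
used for sequences in which every `p₍ₖ₊₁₎` depends on `pₖ`; for the functions `gen` below, the element
`inr k` does not reach the value at `pₖ` before the adjustment number `k - 1`. -/
def ChainLattice (p : ℕ → JoinIrr A) : Type u :=
  {Y : Set (JoinIrr A ⊕ ℕ) // ∀ k, .inl (p (k + 1)) ∈ Y → .inr k ∈ Y → .inr (k + 1) ∈ Y}

namespace ChainLattice

variable {p : ℕ → JoinIrr A}

instance : PartialOrder (ChainLattice p) := inferInstanceAs (PartialOrder (Subtype _))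

instance : InfSet (ChainLattice p) where
  sInf s := ⟨{y | ∀ Y ∈ s, y ∈ Y.1}, fun k hu hk Y hY => Y.2 k (hu Y hY) (hk Y hY)⟩

instance : CompleteLattice (ChainLattice p) :=
  completeLatticeOfInf _ fun _ => ⟨fun Y hY _ hy => hy Y hY, fun _ hZ _ hy _ hY => hZ hY hy⟩

/-- The closed set `{inr k}`. -/
def point (p : ℕ → JoinIrr A) (k : ℕ) : ChainLattice p := ⟨{.inr k}, fun _ h => by simp at h⟩

theorem point_le {k : ℕ} {Y : ChainLattice p} : point p k ≤ Y ↔ .inr k ∈ Y.1 :=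
  Set.singleton_subset_iff

theorem mem_of_le {Y Z : ChainLattice p} (h : Y ≤ Z) {y : JoinIrr A ⊕ ℕ} (hy : y ∈ Y.1) :
    y ∈ Z.1 := h hy

variable [OrderBot A] {I : ℕ → Finset (JoinIrr A)}

/-- The generators: `gen j` consists of `inl j`, of all `inr k` such that `j` is a member of `Iₖ`
other than `pₖ`, and of `inr 0` if `j = p₀`. -/
def gen (hI : ∀ k, IsMinimalPair (p (k + 1)) (I k)) (hp : ∀ k, p k ∈ I k) (j : JoinIrr A) :
    ChainLattice p :=
  ⟨{y | y.elim (· = j) fun k => (j ∈ I k ∧ j ≠ p k) ∨ (k = 0 ∧ j = p 0)}, by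
    rintro k rfl (⟨h, -⟩ | ⟨rfl, h⟩)
    · exact absurd h (hI k).notMem
    · exact absurd (h ▸ hp 0) (hI 0).notMem⟩

variable [Finite A]

/-- An upper bound for the `m`-th adjustment of `gen` at `q`. -/
def bound (hI : ∀ k, IsMinimalPair (p (k + 1)) (I k)) (hp : ∀ k, p k ∈ I k) (m : ℕ)
    (q : JoinIrr A) : ChainLattice p :=
  ⟨{y | y.elim (q ≤ ·) fun k => q.1 ≤ truncJoin (I k) (p k) ∨ (k ≤ m ∧ q.1 ≤ bigJoin (I k)) ∨
      (k = m + 1 ∧ q = p k)}, by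
    intro k hq hk
    change q ≤ p (k + 1) at hq
    by_cases hne : q = p (k + 1)
    · subst hne
      rcases hk with hk | ⟨hk, -⟩ | ⟨hk, h⟩
      · exact absurd hk ((hI k).not_le_truncJoin (hp k))
      · rcases hk.lt_or_eq with hk | rfl
        · exact .inr (.inl ⟨hk, le_bigJoin (hp (k + 1))⟩)
        · exact .inr (.inr ⟨rfl, rfl⟩)
      · exact absurd (h ▸ hp k) (hI k).notMem
    · exact .inl (le_truncJoin (hp (k + 1)) hq hne)⟩

theorem iterate_adjust_gen_le (hI : ∀ k, IsMinimalPair (p (k + 1)) (I k)) (hp : ∀ k, p k ∈ I k)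
    (m : ℕ) (q : JoinIrr A) : adjust^[m] (gen hI hp) q ≤ bound hI hp m q := by
  induction m generalizing q with
  | zero =>
    rintro (i | k) hy
    · change q ≤ i
      exact ge_of_eq (show i = q from hy)
    · rcases hy with ⟨hy, hne⟩ | ⟨rfl, rfl⟩
      · exact .inl (le_truncJoin hy le_rfl hne)
      · exact .inr (.inl ⟨le_rfl, le_bigJoin (hp 0)⟩)
  | succ m ih =>
    rw [Function.iterate_succ_apply']
    refine adjust_le fun C hC hq y hy => ?_
    have hy' : ∀ r ∈ C, y ∈ (bound hI hp m r).1 := fun r hr =>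
      ih r (mem_of_le (Finset.inf'_le _ hr) hy)
    rcases y with i | k
    · exact hq.trans (bigJoin_le_iff.mpr hy')
    · by_cases hk : k ≤ m + 1
      · refine .inr (.inl ⟨hk, hq.trans (bigJoin_le_iff.mpr fun r hr => ?_)⟩)
        rcases hy' r hr with h | ⟨-, h⟩ | ⟨-, rfl⟩
        · exact h.trans (truncJoin_le _ _)
        · exact h
        · exact le_bigJoin (hp k)
      · refine .inl (hq.trans (bigJoin_le_iff.mpr fun r hr => ?_))
        rcases hy' r hr with h | ⟨h, -⟩ | ⟨h, -⟩
        · exact h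
        · omega
        · omega

/-- The element `inr k` reaches the value at `pₖ` after `k` steps: the minimal pair `⟨p₍ₖ₊₁₎, Iₖ⟩`
passes `inr k` on from `pₖ` to `p₍ₖ₊₁₎`, where `inl p₍ₖ₊₁₎` turns it into `inr (k + 1)`. -/
theorem mem_iterate_adjust_gen (hI : ∀ k, IsMinimalPair (p (k + 1)) (I k)) (hp : ∀ k, p k ∈ I k)
    (k : ℕ) : .inr k ∈ (adjust^[k] (gen hI hp) (p k)).1 := by
  induction k with
  | zero => exact .inr ⟨rfl, rfl⟩
  | succ k ih =>
    refine (adjust^[k + 1] (gen hI hp) (p (k + 1))).2 k ?_ ?_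
    · exact iterate_adjust_mono (gen hI hp) (p (k + 1)) (Nat.zero_le (k + 1)) rfl
    · rw [Function.iterate_succ_apply', ← point_le]
      refine le_adjust ⟨p k, hp k⟩ (hI k).le_join fun q hq => point_le.mpr ?_
      by_cases hne : q = p k
      · exact hne ▸ ih
      · exact iterate_adjust_mono (gen hI hp) q (Nat.zero_le k) (.inl ⟨hq, hne⟩)

end ChainLattice

/-- If the `n`-th adjustment is stationary for all functions into lattices with a top, with `n`
independent of the lattice and of the function, then condition (T) holds. -/
theorem wellFounded_of_iterate_adjust_le [OrderBot A] [Finite A] (n : ℕ)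
    (h : ∀ (M : Type u) [Lattice M] [OrderTop M] (g : JoinIrr A → M) (m : ℕ) (p : JoinIrr A),
      adjust^[m] g p ≤ adjust^[n] g p) : WellFounded (Depends (S := A)) := by
  rw [wellFounded_iff_isEmpty_descending_chain]
  refine ⟨fun ⟨p, hdep⟩ => ?_⟩
  choose I hI hp using hdep
  -- The bound for `n` still admits `inr (n + 1)` at `p (n + 1)`, hence `n + 2`.
  have := h (ChainLattice p) (ChainLattice.gen hI hp) (n + 2) (p (n + 2))
    (ChainLattice.mem_iterate_adjust_gen hI hp (n + 2))
  rcases ChainLattice.iterate_adjust_gen_le hI hp n _ this with h | ⟨h, -⟩ | ⟨h, -⟩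
  · exact (hI (n + 2)).not_le_truncJoin_of_mem (hp (n + 2)) h
  · omega
  · omega

end Chain

/-! ### Meets with a free generator -/

section Free

variable {A : Type u} [SemilatticeSup A] [OrderBot A] [Finite A]

open FreeLat

/-- Whitman's condition for the joins that define an adjustment. -/
theorem inf_le_adjust {X : Type v} {g : JoinIrr A → FreeLat X} {a b : FreeLat X} {p : JoinIrr A}
    (h : a ⊓ b ≤ adjust g p) : a ≤ adjust g p ∨ b ≤ adjust g p ∨
      ∃ C : Finset (JoinIrr A), p.1 ≤ bigJoin C ∧ ∀ q ∈ C, a ⊓ b ≤ g q := by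
  revert h
  refine adjust_induction (P := fun c => a ⊓ b ≤ c → a ≤ c ∨ b ≤ c ∨
    ∃ C : Finset (JoinIrr A), p.1 ≤ bigJoin C ∧ ∀ q ∈ C, a ⊓ b ≤ g q) ?_ ?_
  · intro c d hc hd h
    rcases inf_le_sup_iff.mp h with h | h | h | h
    · exact .inl h
    · exact .inr (.inl h)
    · rcases hc h with h | h | h
      · exact .inl (le_sup_of_le_left h)
      · exact .inr (.inl (le_sup_of_le_left h))
      · exact .inr (.inr h)
    · rcases hd h with h | h | h
      · exact .inl (le_sup_of_le_right h)
      · exact .inr (.inl (le_sup_of_le_right h))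
      · exact .inr (.inr h)
  · exact fun C hC hp h => .inr (.inr ⟨C, hp, fun q hq => h.trans (Finset.inf'_le g hq)⟩)

/-- The free generators indexed by the join-irreducible elements. -/
def freeGen (p : JoinIrr A) : FreeLat (Option (JoinIrr A)) := var (some p)

/-- The meets of the `n`-th adjustment of the free generators with the additional generator
`var none`. -/
noncomputable def cutGen (n : ℕ) (p : JoinIrr A) : FreeLat (Option (JoinIrr A)) :=
  var none ⊓ adjust^[n] freeGen p

/-- If a homomorphism bounds the free generators by a function `c` that is not increased by
adjustment, then it bounds all iterated adjustments of `cutGen` by `c`. -/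
theorem map_iterate_adjust_cutGen_le {M : Type v} [Lattice M]
    (h : LatticeHom (FreeLat (Option (JoinIrr A))) M) {c : JoinIrr A → M}
    (hc : ∀ q, adjust c q ≤ c q) (hg : ∀ q, h (freeGen q) ≤ c q) (n k : ℕ) (p : JoinIrr A) :
    h (adjust^[k] (cutGen n) p) ≤ c p := by
  have hn : ∀ q, h (adjust^[n] freeGen q) ≤ c q := fun q =>
    (congrFun (map_iterate_adjust h freeGen n) q).trans_le (iterate_adjust_le hg hc n q)
  refine (congrFun (map_iterate_adjust h (cutGen n) k) p).trans_le (iterate_adjust_le ?_ hc k p)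
  exact fun q => (map_inf h _ _).trans_le (inf_le_right.trans (hn q))

/-- The only way for an adjusted meet with the free generator `var none` to be contained in an
iterated adjustment of such meets is the trivial one. -/
theorem inf_le_cutGen {m n k : ℕ} {p : JoinIrr A} (h : cutGen m p ≤ adjust^[k] (cutGen n) p) :
    cutGen m p ≤ cutGen n p := by
  induction k with
  | zero => exact h
  | succ k ih =>
    have hp : freeGen p ≤ adjust^[m] freeGen p := iterate_adjust_mono freeGen p (Nat.zero_le m)
    have h' := h
    rw [Function.iterate_succ_apply'] at h'
    rcases inf_le_adjust h' with h₁ | h₁ | ⟨C, hpC, hC⟩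
    · -- The generator `var none` is not below the other ones.
      rw [← Function.iterate_succ_apply' adjust] at h₁
      let f : LatticeHom (FreeLat (Option (JoinIrr A))) Prop := lift fun o => o = none
      have h₂ : f (adjust^[k + 1] (cutGen n) p) ≤ False :=
        map_iterate_adjust_cutGen_le f (c := fun _ => False) (adjust_const_le _)
          (fun q => show some q = none → False by simp) n (k + 1) p
      exact (h₂ (OrderHomClass.mono f h₁ rfl)).elim
    · -- The other generators are not below `var none`.
      rw [← Function.iterate_succ_apply' adjust] at h₁
      let f : LatticeHom (FreeLat (Option (JoinIrr A))) Prop := lift fun o => o ≠ none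
      have h₂ : adjust^[k + 1] (cutGen n) p ≤ var none :=
        iterate_adjust_le (c := fun _ => var none) (fun q => inf_le_left) (adjust_const_le _) _ p
      have h₃ : f (freeGen p) ≤ f (var none) := OrderHomClass.mono f (hp.trans (h₁.trans h₂))
      exact (h₃ (Option.some_ne_none p) rfl).elim
    · -- The generator of `p` is involved at `q` only if `q ≤ p`, hence the cover `C` is trivial.
      have hCp : ∀ q ∈ C, q ≤ p := fun q hq => by
        let f : LatticeHom (FreeLat (Option (JoinIrr A))) Prop :=
          lift fun o => o = none ∨ o = some p
        have h₂ : f (adjust^[k] (cutGen n) q) ≤ (q ≤ p) :=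
          map_iterate_adjust_cutGen_le f (c := (· ≤ p))
            (fun q => adjust_le fun D hD hqD hle => hqD.trans (bigJoin_le_iff.mpr fun r hr =>
              Finset.inf'_le (· ≤ p) hr hle))
            (fun q => show some q = none ∨ some q = some p → q ≤ p by
              simpa using fun e => e.le) n k q
        have h₃ : f (cutGen m p) := by
          have : f (var none ⊓ freeGen p) := by
            rw [map_inf]
            exact ⟨.inl rfl, .inr rfl⟩
          exact OrderHomClass.mono f (inf_le_inf_left _ hp) this
        exact h₂ (OrderHomClass.mono f (hC q hq) h₃)
      exact ih (hC p (mem_of_val_eq_bigJoin (le_antisymm hpC (bigJoin_le_iff.mpr hCp))))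

/-- If `A ⊗ L` is a lattice and `L` contains the free lattice over the join-irreducible elements
and one further generator `w`, then condition (T) holds: the bi-ideal generated by the free
generators and the bi-ideal of all pairs with second entry at most `w` intersect in a finitely
generated bi-ideal, which is already generated by the meets of `w` with some iterated adjustment. -/
theorem wellFounded_of_isLatticeOrdered {L : Type v} [Lattice L] [OrderBot L]
    (f : LatticeHom (FreeLat (Option (JoinIrr A))) L) (hf : ∀ a b, f a ≤ f b → a ≤ b)
    (hlat : IsLatticeOrdered (Tensor A L)) : WellFounded (Depends (S := A)) := by
  have := Fintype.ofFinite (JoinIrr A)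
  obtain ⟨z, hz⟩ := hlat (Finset.univ.sup fun p : JoinIrr A => tens p.1 (f (freeGen p)))
    (Finset.univ.sup fun p : JoinIrr A => tens p.1 (f (var none)))
  obtain ⟨t⟩ := z
  change IsGLB _ (Tensor.mk t) at hz
  have hgen : ∀ y ∈ t, ∃ n, ∀ p : JoinIrr A, p.1 ≤ y.1.1 → y.2.1 ≤ f (cutGen n p) := by
    intro y hy
    have hyz := Tensor.mk_le_iff.mp le_rfl y hy
    obtain ⟨m, hm⟩ := (isBiIdeal_iterate_adjust (A := A) (f ∘ freeGen)).of_tens_le_sup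
      (fun p _ => ⟨1, fun q hq => le_adjust (Finset.singleton_nonempty p)
        (hq.trans (le_bigJoin (Finset.mem_singleton_self p))) (by simp)⟩)
      (hyz.trans (hz.1 (.inl rfl)))
    obtain ⟨n, hn⟩ := (isBiIdeal_iterate_adjust fun _ : JoinIrr A => f (var none)).of_tens_le_sup
      (fun p _ => ⟨0, fun q hq => le_rfl⟩) (hyz.trans (hz.1 (.inr rfl)))
    refine ⟨m, fun p hp => le_trans (le_inf ?_ ?_) (map_inf f _ _).ge⟩
    · exact (hn p hp).trans (iterate_adjust_le (fun _ => le_rfl) (adjust_const_le _) n p)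
    · exact (hm p hp).trans_eq (congrFun (map_iterate_adjust f freeGen m) p).symm
  choose! N hN using hgen
  -- The finitely many generators of the meet are all bounded by a single `cutGen n`.
  let n := t.sup N
  have hcut : ∀ m (p : JoinIrr A), cutGen m p ≤ cutGen n p := by
    intro m p
    have hle : tens p.1 (f (cutGen m p)) ≤ Tensor.mk t := by
      refine hz.2 ?_
      rintro _ (rfl | rfl)
      · refine (tens_mono le_rfl (OrderHomClass.mono f inf_le_right)).trans ?_
        refine (tens_mono le_rfl (congrFun (map_iterate_adjust f freeGen m) p).le).trans ?_
        exact tens_iterate_adjust_le (fun q => Finset.le_sup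
          (f := fun p : JoinIrr A => tens p.1 (f (freeGen p))) (Finset.mem_univ q)) m p
      · exact (tens_mono le_rfl (OrderHomClass.mono f inf_le_left)).trans (Finset.le_sup
          (f := fun p : JoinIrr A => tens p.1 (f (var none))) (Finset.mem_univ p))
    obtain ⟨k, hk⟩ := (isBiIdeal_iterate_adjust (A := A) (f ∘ cutGen n)).of_tens_le (t := t)
      (fun y hy => ⟨0, fun p hp => (hN y hy p hp).trans (OrderHomClass.mono f (inf_le_inf_left _
        (iterate_adjust_mono freeGen p (Finset.le_sup hy))))⟩) hle
    refine inf_le_cutGen (k := k) (hf _ _ ((hk p le_rfl).trans_eq ?_))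
    exact (congrFun (map_iterate_adjust f (cutGen n) k) p).symm
  refine wellFounded_of_iterate_adjust_le n fun M _ _ g m p => ?_
  -- Substituting the top element for `var none` turns `hcut` into an inequality of adjustments.
  let h : LatticeHom (FreeLat (Option (JoinIrr A))) M := lift (Option.elim · ⊤ g)
  have hval : ∀ m, h (cutGen (A := A) m p) = adjust^[m] g p := fun m => by
    refine (map_inf h _ _).trans ?_
    rw [show h (var none) = ⊤ from rfl, top_inf_eq]
    exact congrFun (map_iterate_adjust h (freeGen (A := A)) m) p
  rw [← hval, ← hval]
  exact OrderHomClass.mono h (hcut m p)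

end Free

end Amenable

theorem theorem3p1 {A : Type u} [Lattice A] [Finite A] [OrderBot A] :
    [Amenable.IsAmenable.{u, v} A,
      Amenable.IsSharplyTransferable.{u, w} A,
      Amenable.IsLatticeOrdered (Amenable.Tensor A Amenable.F3),
      Amenable.ConditionT A].TFAE := by
  rw [Amenable.conditionT_iff_wellFounded]
  obtain ⟨f, hf⟩ := Amenable.FreeLat.exists_embedding_F3 (Option (Amenable.JoinIrr A))
  tfae_have 4 → 1 := fun h L _ _ => Amenable.isLatticeOrdered_of_wellFounded h
  tfae_have 4 → 3 := Amenable.isLatticeOrdered_of_wellFounded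
  tfae_have 4 → 2 := Amenable.isSharplyTransferable_of_wellFounded
  tfae_have 2 → 4 := Amenable.wellFounded_of_isSharplyTransferable
  tfae_have 3 → 4 := Amenable.wellFounded_of_isLatticeOrdered f hf
  tfae_have 1 → 4 := by
    intro h
    let up : LatticeHom Amenable.F3 (ULift.{v} Amenable.F3) :=
      { toFun := ULift.up, map_sup' := fun _ _ => rfl, map_inf' := fun _ _ => rfl }
    exact Amenable.wellFounded_of_isLatticeOrdered (up.comp f) (fun a b hab => hf a b hab) (h _)
  tfae_finish
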